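/- All Hilbert spaces are finite-dimensional, non-zero, and carry fixed orthonormal bases. The link product of $F\in\mathcal B(\mathcal H_X\otimes\mathcal H_Y)$ and $L\in\mathcal B(\mathcal H_Y\otimes\mathcal H_Z)$ is $F\star L=\operatorname{tr}_Y[(F\otimes\mathbb 1_Z)(\mathbb 1_X\otimes L^{\mathrm T_Y})]$, and $\Phi^+=\sum_{i,j}|ii\rangle\langle jj|$. Channels are CPTP maps and are identified with their Choi matrices. A (three-party) comb of order $A\prec B\prec C$ is an operator $W\ge 0$ on $A_IA_OB_IB_OC_IC_O$ such that $W=W_{ABC_I}\otimes\mathbb 1_{C_O}$, $\operatorname{tr}_{C_I}W_{ABC_I}=W_{AB_I}\otimes\mathbb 1_{B_O}$, $\operatorname{tr}_{B_I}W_{AB_I}=W_{A_I}\otimes\mathbb 1_{A_O}$ and $\operatorname{tr}W_{A_I}=1$, for some operators $W_{ABC_I}$, $W_{AB_I}$, $W_{A_I}$. An adapter is an operator $\Upsilon$ on $\bigotimes_{X\in\{A,B,C\}}X_IX_OX_I'X_O'$; it maps an operator $W$ on the unprimed systems to the operator $\Upsilon\star W$ on the primed ones. * $\Upsilon$ is an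 adapter from local operations and shared entanglement (LOSE) if $\Upsilon=\tau\star\Lambda_A\star\Gamma_A\star\Lambda_B\star\Gamma_B\star\Lambda_C\star\Gamma_C$, where $\tau$ is a density operator on $\widetilde A_I\widetilde A_O'\widetilde B_I\widetilde B_O'\widetilde C_I\widetilde C_O'$ and, for each party $X$, $\Lambda_X$ is a channel $X_I\widetilde X_I\to X_I'\widetilde X_I'$ and $\Gamma_X$ is a channel $X_O'\widetilde X_I'\widetilde X_O'\to X_O$; the spaces with a tilde have arbitrary finite dimensions. * $\Upsilon$ is a non-signalling (free) adapter if $\Upsilon\ge 0$, $\Upsilon=(L_A\otimes L_B\otimes L_C)[\Upsilon]$ and $\operatorname{tr}\Upsilon=\prod_X d_{X_I}d_{X_O'}$, where ${}_Y\Upsilon=\frac{\mathbb 1_Y}{d_Y}\otimes\operatorname{tr}_Y\Upsilon$ and $L_X[\Upsilon]=\Upsilon-{}_{X_O}\Upsilon+{}_{X_OX_O'}\Upsilon-{}_{X_I'X_OX_O'}\Upsilon+{}_{X_IX_I'X_OX_O'}\Upsilon$. **Theorem.** Let $d_{A_O}=d_{B_I}$ and $d_{B_O}=d_{C_I}$,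 let $\rho$ be a density operator on $A_I$, and let $$W^{A\to B\to C}=\rho_{A_I}\otimes\Phi^+_{A_OB_I}\otimes\Phi^+_{B_OC_I}\otimes\mathbb 1_{C_O}.$$ Then $W^{A\to B\to C}$ is a comb of order $A\prec B\prec C$, and it is the most resourceful one: for all systems $A_I',A_O',B_I',B_O',C_I',C_O'$ whose dimensions do not exceed those of the corresponding systems of $W^{A\to B\to C}$, and for every comb $W'$ of order $A'\prec B'\prec C'$ on them, there is an adapter $\Upsilon$ that is LOSE, and hence non-signalling, such that $\Upsilon\star W^{A\to B\to C}=W'$. -/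

import Mathlib

open scoped Kronecker ComplexOrder

namespace CausalConnection

/-! A finite-dimensional Hilbert space with a fixed orthonormal basis is given by the finite
type `X` that labels the basis; an operator on it is a `Matrix X X ℂ`, and a tensor product of
spaces is labelled by the product of the label types. -/

section Basic

variable {X Y Z I O S R ι : Type*}

/-- The partial trace `tr_Y M` of an operator on `X ⊗ Y`. -/
def partialTrace [Fintype Y] (M : Matrix (X × Y) (X × Y) ℂ) : Matrix X X ℂ :=
  Matrix.of fun x x' => ∑ y, M (x, y) (x', y)

/-- The partial transpose `L^{T_Y}` of an operator on `Y ⊗ Z`. -/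
def partialTranspose (L : Matrix (Y × Z) (Y × Z) ℂ) : Matrix (Y × Z) (Y × Z) ℂ :=
  Matrix.of fun p q => L (q.1, p.2) (p.1, q.2)

open Classical in
/-- The link product `F ⋆ L = tr_Y [(F ⊗ 𝟙_Z) (𝟙_X ⊗ L^{T_Y})]` of operators on `X ⊗ Y` and on
`Y ⊗ Z`; it is an operator on `X ⊗ Z`. -/
noncomputable def linkProduct [Fintype X] [Fintype Y] [Fintype Z]
    (F : Matrix (X × Y) (X × Y) ℂ) (L : Matrix (Y × Z) (Y × Z) ℂ) :
    Matrix (X × Z) (X × Z) ℂ :=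
  partialTrace
    (((F ⊗ₖ (1 : Matrix Z Z ℂ)) *
      ((1 : Matrix X X ℂ) ⊗ₖ partialTranspose L).submatrix
        (Equiv.prodAssoc X Y Z) (Equiv.prodAssoc X Y Z)).submatrix
      (fun p : (X × Z) × Y => ((p.1.1, p.2), p.1.2))
      (fun p : (X × Z) × Y => ((p.1.1, p.2), p.1.2)))

theorem linkProduct_apply [Fintype X] [Fintype Y] [Fintype Z]
    (F : Matrix (X × Y) (X × Y) ℂ) (L : Matrix (Y × Z) (Y × Z) ℂ) (p q : X × Z) :
    linkProduct F L p q = ∑ y, ∑ y', F (p.1, y) (q.1, y') * L (y, p.2) (y', q.2) := by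
  classical
  simp only [linkProduct, partialTrace, partialTranspose, Matrix.of_apply,
    Matrix.submatrix_apply, Matrix.mul_apply, Fintype.sum_prod_type, Matrix.kroneckerMap_apply,
    Matrix.one_apply, Equiv.prodAssoc_apply]
  refine Finset.sum_congr rfl fun y _ => ?_
  rw [Finset.sum_comm]
  refine Finset.sum_congr rfl fun y' _ => ?_
  rw [Finset.sum_eq_single q.1, Finset.sum_eq_single p.2]
  · simp
  · intro b _ hb
    simp [hb.symm]
  · simp
  · intro b _ hb
    simp [hb]
  · simp

/-- Quantum states (density operators). -/
def IsState [Fintype X] (ρ : Matrix X X ℂ) : Prop :=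
  ρ.PosSemidef ∧ ρ.trace = 1

/-- `M`, an operator on `I ⊗ O`, is the Choi matrix of a completely positive trace-preserving map
with input space `I` and output space `O`. -/
def IsChannel [Fintype I] [Fintype O] [DecidableEq I] (M : Matrix (I × O) (I × O) ℂ) : Prop :=
  M.PosSemidef ∧ partialTrace M = 1

/-- `Φ⁺ = ∑_{i,j} |ii⟩⟨jj|`, the Choi matrix of the identity channel. -/
def phiPlus (I : Type*) [DecidableEq I] : Matrix (I × I) (I × I) ℂ :=
  Matrix.of fun p q => if p.1 = p.2 ∧ q.1 = q.2 then 1 else 0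

/-- `_S M = (𝟙_S / d_S) ⊗ tr_S M`, where `e` singles out the tensor factor `S`. -/
noncomputable def traceReplace [Fintype S] [DecidableEq S] (e : ι ≃ S × R)
    (M : Matrix ι ι ℂ) : Matrix ι ι ℂ :=
  Matrix.of fun i j =>
    if (e i).1 = (e j).1 then
      (Fintype.card S : ℂ)⁻¹ * ∑ s, M (e.symm (s, (e i).2)) (e.symm (s, (e j).2))
    else 0

end Basic

section Combs

/-- Basis labels of `A_I A_O B_I B_O C_I C_O`. -/
abbrev TriIndex (AI AO BI BO CI CO : Type*) : Type _ := (AI × AO) × (BI × BO) × (CI × CO)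

variable {AI AO BI BO CI CO : Type*}

/-- Three-party combs (causally ordered three-party process matrices) of order `A ≺ B ≺ C`:
`W ≥ 0`, `W = W_{A B C_I} ⊗ 𝟙_{C_O}`, `tr_{C_I} W_{A B C_I} = W_{A B_I} ⊗ 𝟙_{B_O}`,
`tr_{B_I} W_{A B_I} = W_{A_I} ⊗ 𝟙_{A_O}` and `tr W_{A_I} = 1`. -/
def IsOrderedComb [Fintype AI] [Fintype BI] [Fintype CI]
    [DecidableEq AO] [DecidableEq BO] [DecidableEq CO]
    (W : Matrix (TriIndex AI AO BI BO CI CO) (TriIndex AI AO BI BO CI CO) ℂ) : Prop :=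
  W.PosSemidef ∧
  ∃ (W₃ : Matrix (((AI × AO) × (BI × BO)) × CI) (((AI × AO) × (BI × BO)) × CI) ℂ)
    (W₂ : Matrix ((AI × AO) × BI) ((AI × AO) × BI) ℂ)
    (W₁ : Matrix AI AI ℂ),
    (∀ a b cI cO a' b' cI' cO',
      W (a, b, (cI, cO)) (a', b', (cI', cO')) =
        W₃ ((a, b), cI) ((a', b'), cI') * (1 : Matrix CO CO ℂ) cO cO') ∧
    (∀ a bI bO a' bI' bO',
      partialTrace W₃ (a, (bI, bO)) (a', (bI', bO')) =
        W₂ (a, bI) (a', bI') * (1 : Matrix BO BO ℂ) bO bO') ∧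
    partialTrace W₂ = W₁ ⊗ₖ (1 : Matrix AO AO ℂ) ∧
    W₁.trace = 1

/-- `W^{A → B → C} = ρ_{A_I} ⊗ Φ⁺_{A_O B_I} ⊗ Φ⁺_{B_O C_I} ⊗ 𝟙_{C_O}`. The spaces `A_O` and `B_I`
have the same labels `M`, and the spaces `B_O` and `C_I` have the same labels `N`. -/
def fullySignalling {M N : Type*} [DecidableEq M] [DecidableEq N] [DecidableEq CO]
    (ρ : Matrix AI AI ℂ) : Matrix (TriIndex AI M M N N CO) (TriIndex AI M M N N CO) ℂ :=
  Matrix.of fun (i j : (AI × M) × (M × N) × (N × CO)) =>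
    match i, j with
    | ((aI, aO), (bI, bO), (cI, cO)), ((aI', aO'), (bI', bO'), (cI', cO')) =>
      ρ aI aI' * phiPlus M (aO, bI) (aO', bI') * phiPlus N (bO, cI) (bO', cI') *
        (1 : Matrix CO CO ℂ) cO cO'

end Combs

section Adapters

variable {XI XO XI' XO' AI AO BI BO CI CO AI' AO' BI' BO' CI' CO' R ι : Type*}

/-- The local operation `Λ ⋆ Γ` of one party `X`, linked along the memory `SI`. Here `Λ` is a map
`X_I ⊗ TI → X_I' ⊗ SI` (pre-processing) and `Γ` is a map `X_O' ⊗ SI ⊗ TO → X_O`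
(post-processing); `TI` and `TO` are the party's two shares of the entangled state.
The result is an operator on `(TI ⊗ TO) ⊗ ((X_I ⊗ X_O) ⊗ (X_I' ⊗ X_O'))`. -/
noncomputable def localOperation {TI TO SI : Type*}
    [Fintype XI] [Fintype XO] [Fintype XI'] [Fintype XO'] [Fintype TI] [Fintype TO] [Fintype SI]
    (Λ : Matrix ((XI × TI) × (XI' × SI)) ((XI × TI) × (XI' × SI)) ℂ)
    (Γ : Matrix ((XO' × (SI × TO)) × XO) ((XO' × (SI × TO)) × XO) ℂ) :
    Matrix ((TI × TO) × ((XI × XO) × (XI' × XO'))) ((TI × TO) × ((XI × XO) × (XI' × XO'))) ℂ :=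
  let f : (TI × XI × XI') × SI → (XI × TI) × (XI' × SI) :=
    fun | ((tI, xI, xI'), s) => ((xI, tI), (xI', s))
  let g : SI × (TO × XO × XO') → (XO' × (SI × TO)) × XO :=
    fun | (s, (tO, xO, xO')) => ((xO', (s, tO)), xO)
  let h : (TI × TO) × ((XI × XO) × (XI' × XO')) → (TI × XI × XI') × (TO × XO × XO') :=
    fun | ((tI, tO), ((xI, xO), (xI', xO'))) => ((tI, xI, xI'), (tO, xO, xO'))
  (linkProduct (Λ.submatrix f f) (Γ.submatrix g g)).submatrix h h

/-- `K` is a local operation of one party: `K = Λ ⋆ Γ` for channels `Λ` and `Γ` as above and a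
memory of arbitrary finite dimension. -/
def IsLocalOperation {TI TO : Type}
    [Fintype XI] [Fintype XO] [Fintype XI'] [Fintype XO'] [Fintype TI] [Fintype TO]
    [DecidableEq XI] [DecidableEq XO'] [DecidableEq TI] [DecidableEq TO]
    (K : Matrix ((TI × TO) × ((XI × XO) × (XI' × XO')))
      ((TI × TO) × ((XI × XO) × (XI' × XO'))) ℂ) : Prop :=
  ∃ (SI : Type) (_ : Fintype SI) (_ : DecidableEq SI)
    (Λ : Matrix ((XI × TI) × (XI' × SI)) ((XI × TI) × (XI' × SI)) ℂ)
    (Γ : Matrix ((XO' × (SI × TO)) × XO) ((XO' × (SI × TO)) × XO) ℂ),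
    IsChannel Λ ∧ IsChannel Γ ∧ K = localOperation Λ Γ

/-- Basis labels of the space on which a three-party adapter acts: the systems of the process that
is transformed, then the (primed) systems of the resulting process. -/
abbrev AdapterIndex (AI AO BI BO CI CO AI' AO' BI' BO' CI' CO' : Type*) : Type _ :=
  TriIndex AI AO BI BO CI CO × TriIndex AI' AO' BI' BO' CI' CO'

/-- The link product `ρ ⋆ L` of an operator `ρ` on `Y` and an operator `L` on `Y ⊗ Z`. -/
noncomputable def linkAll {Y Z : Type*} [Fintype Y] [Fintype Z]
    (ρ : Matrix Y Y ℂ) (L : Matrix (Y × Z) (Y × Z) ℂ) : Matrix Z Z ℂ :=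
  (linkProduct (ρ.submatrix (Prod.snd : Unit × Y → Y) Prod.snd) L).submatrix
    (fun z => ((), z)) (fun z => ((), z))

/-- The action `W ↦ Υ ⋆ W` of a three-party adapter on a three-party process. -/
noncomputable def applyAdapter [Fintype AI] [Fintype AO] [Fintype BI] [Fintype BO] [Fintype CI] [Fintype CO]
    [Fintype AI'] [Fintype AO'] [Fintype BI'] [Fintype BO'] [Fintype CI'] [Fintype CO']
    (Υ : Matrix (AdapterIndex AI AO BI BO CI CO AI' AO' BI' BO' CI' CO')
      (AdapterIndex AI AO BI BO CI CO AI' AO' BI' BO' CI' CO') ℂ)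
    (W : Matrix (TriIndex AI AO BI BO CI CO) (TriIndex AI AO BI BO CI CO) ℂ) :
    Matrix (TriIndex AI' AO' BI' BO' CI' CO') (TriIndex AI' AO' BI' BO' CI' CO') ℂ :=
  linkAll W Υ

/-- The tensor product of the local operations of the three parties; all shares of the entangled
state come first, then the labels of the adapter. -/
def tensorLocal {TA TB TC A B C A' B' C' : Type*}
    (KA : Matrix (TA × (A × A')) (TA × (A × A')) ℂ)
    (KB : Matrix (TB × (B × B')) (TB × (B × B')) ℂ)
    (KC : Matrix (TC × (C × C')) (TC × (C × C')) ℂ) :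
    Matrix ((TA × TB × TC) × ((A × B × C) × (A' × B' × C')))
      ((TA × TB × TC) × ((A × B × C) × (A' × B' × C'))) ℂ :=
  let f : (TA × TB × TC) × ((A × B × C) × (A' × B' × C')) →
      (TA × (A × A')) × (TB × (B × B')) × (TC × (C × C')) :=
    fun | ((tA, tB, tC), ((a, b, c), (a', b', c'))) =>
          ((tA, (a, a')), (tB, (b, b')), (tC, (c, c')))
  (KA ⊗ₖ (KB ⊗ₖ KC)).submatrix f f

/-- Three-party adapters from local operations and shared entanglement: the parties share a state
`τ` on ancillary systems of arbitrary finite dimension (party `X` holds `TXI` and `TXO`) and each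
party performs a local operation. -/
def IsLOSE
    [Fintype AI] [Fintype AO] [Fintype BI] [Fintype BO] [Fintype CI] [Fintype CO]
    [Fintype AI'] [Fintype AO'] [Fintype BI'] [Fintype BO'] [Fintype CI'] [Fintype CO']
    [DecidableEq AI] [DecidableEq BI] [DecidableEq CI]
    [DecidableEq AO'] [DecidableEq BO'] [DecidableEq CO']
    (Υ : Matrix (AdapterIndex AI AO BI BO CI CO AI' AO' BI' BO' CI' CO')
      (AdapterIndex AI AO BI BO CI CO AI' AO' BI' BO' CI' CO') ℂ) : Prop :=
  ∃ (TAI TAO TBI TBO TCI TCO : Type)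
    (_ : Fintype TAI) (_ : Fintype TAO) (_ : Fintype TBI) (_ : Fintype TBO)
    (_ : Fintype TCI) (_ : Fintype TCO)
    (_ : DecidableEq TAI) (_ : DecidableEq TAO) (_ : DecidableEq TBI) (_ : DecidableEq TBO)
    (_ : DecidableEq TCI) (_ : DecidableEq TCO)
    (τ : Matrix (TriIndex TAI TAO TBI TBO TCI TCO) (TriIndex TAI TAO TBI TBO TCI TCO) ℂ)
    (KA : Matrix ((TAI × TAO) × ((AI × AO) × (AI' × AO')))
      ((TAI × TAO) × ((AI × AO) × (AI' × AO'))) ℂ)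
    (KB : Matrix ((TBI × TBO) × ((BI × BO) × (BI' × BO')))
      ((TBI × TBO) × ((BI × BO) × (BI' × BO'))) ℂ)
    (KC : Matrix ((TCI × TCO) × ((CI × CO) × (CI' × CO')))
      ((TCI × TCO) × ((CI × CO) × (CI' × CO'))) ℂ),
    IsState τ ∧ IsLocalOperation KA ∧ IsLocalOperation KB ∧ IsLocalOperation KC ∧
    Υ = linkAll τ (tensorLocal KA KB KC)

/-! `splitI`, `splitO`, `splitI'` and `splitO'` single out one system of a party. -/

def splitI : ((XI × XO) × (XI' × XO')) × R ≃ XI × (XO × XI' × XO' × R) where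
  toFun := fun | (((xI, xO), (xI', xO')), r) => (xI, (xO, xI', xO', r))
  invFun := fun | (xI, (xO, xI', xO', r)) => (((xI, xO), (xI', xO')), r)
  left_inv _ := rfl
  right_inv _ := rfl

def splitO : ((XI × XO) × (XI' × XO')) × R ≃ XO × (XI × XI' × XO' × R) where
  toFun := fun | (((xI, xO), (xI', xO')), r) => (xO, (xI, xI', xO', r))
  invFun := fun | (xO, (xI, xI', xO', r)) => (((xI, xO), (xI', xO')), r)
  left_inv _ := rfl
  right_inv _ := rfl

def splitI' : ((XI × XO) × (XI' × XO')) × R ≃ XI' × (XI × XO × XO' × R) where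
  toFun := fun | (((xI, xO), (xI', xO')), r) => (xI', (xI, xO, xO', r))
  invFun := fun | (xI', (xI, xO, xO', r)) => (((xI, xO), (xI', xO')), r)
  left_inv _ := rfl
  right_inv _ := rfl

def splitO' : ((XI × XO) × (XI' × XO')) × R ≃ XO' × (XI × XO × XI' × R) where
  toFun := fun | (((xI, xO), (xI', xO')), r) => (xO', (xI, xO, xI', r))
  invFun := fun | (xO', (xI, xO, xI', r)) => (((xI, xO), (xI', xO')), r)
  left_inv _ := rfl
  right_inv _ := rfl

/-- The projector
`L_X[Υ] = Υ - _{X_O}Υ + _{X_O X_O'}Υ - _{X_I' X_O X_O'}Υ + _{X_I X_I' X_O X_O'}Υ`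
of one party `X`, where `e` singles out the systems of that party. -/
noncomputable def nsProjector [Fintype XI] [Fintype XO] [Fintype XI'] [Fintype XO']
    [DecidableEq XI] [DecidableEq XO] [DecidableEq XI'] [DecidableEq XO']
    (e : ι ≃ ((XI × XO) × (XI' × XO')) × R) (Υ : Matrix ι ι ℂ) : Matrix ι ι ℂ :=
  let Υ₁ := traceReplace (e.trans splitO) Υ
  let Υ₂ := traceReplace (e.trans splitO') Υ₁
  let Υ₃ := traceReplace (e.trans splitI') Υ₂
  let Υ₄ := traceReplace (e.trans splitI) Υ₃
  Υ - Υ₁ + Υ₂ - Υ₃ + Υ₄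

/-! `splitA`, `splitB` and `splitC` single out the systems of one party of an adapter. -/

def splitA {A B C A' B' C' : Type*} :
    (A × B × C) × (A' × B' × C') ≃ (A × A') × (B × C × B' × C') where
  toFun := fun | ((a, b, c), (a', b', c')) => ((a, a'), (b, c, b', c'))
  invFun := fun | ((a, a'), (b, c, b', c')) => ((a, b, c), (a', b', c'))
  left_inv _ := rfl
  right_inv _ := rfl

def splitB {A B C A' B' C' : Type*} :
    (A × B × C) × (A' × B' × C') ≃ (B × B') × (A × C × A' × C') where
  toFun := fun | ((a, b, c), (a', b', c')) => ((b, b'), (a, c, a', c'))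
  invFun := fun | ((b, b'), (a, c, a', c')) => ((a, b, c), (a', b', c'))
  left_inv _ := rfl
  right_inv _ := rfl

def splitC {A B C A' B' C' : Type*} :
    (A × B × C) × (A' × B' × C') ≃ (C × C') × (A × B × A' × B') where
  toFun := fun | ((a, b, c), (a', b', c')) => ((c, c'), (a, b, a', b'))
  invFun := fun | ((c, c'), (a, b, a', b')) => ((a, b, c), (a', b', c'))
  left_inv _ := rfl
  right_inv _ := rfl

/-- Three-party non-signalling (free) adapters: `Υ ≥ 0`, `Υ = (L_A ⊗ L_B ⊗ L_C)[Υ]`, and `tr Υ` is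
the product of the dimensions of `X_I` and of `X_O'` over the three parties `X`. -/
def IsNonSignalling
    [Fintype AI] [Fintype AO] [Fintype BI] [Fintype BO] [Fintype CI] [Fintype CO]
    [Fintype AI'] [Fintype AO'] [Fintype BI'] [Fintype BO'] [Fintype CI'] [Fintype CO']
    [DecidableEq AI] [DecidableEq AO] [DecidableEq BI] [DecidableEq BO] [DecidableEq CI]
    [DecidableEq CO]
    [DecidableEq AI'] [DecidableEq AO'] [DecidableEq BI'] [DecidableEq BO'] [DecidableEq CI']
    [DecidableEq CO']
    (Υ : Matrix (AdapterIndex AI AO BI BO CI CO AI' AO' BI' BO' CI' CO')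
      (AdapterIndex AI AO BI BO CI CO AI' AO' BI' BO' CI' CO') ℂ) : Prop :=
  Υ.PosSemidef ∧
  Υ = nsProjector splitA (nsProjector splitB (nsProjector splitC Υ)) ∧
  Υ.trace =
    Fintype.card AI * Fintype.card AO' * (Fintype.card BI * Fintype.card BO') *
      (Fintype.card CI * Fintype.card CO')

end Adapters

end CausalConnection

open CausalConnection

/-! A comb is a quantum circuit with memory, and the two identity wires of `fullySignalling ρ` let
the parties run such a circuit themselves. By `IsOrderedComb.exists_realization`, every comb arises
from a pure state on A_I' and a memory, an isometry from memory and A_O' to B_I' and a new memory,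
and an isometry from that memory and B_O' to C_I' and an environment that is discarded.

The pure state serves as the entanglement shared by the first two parties. The first one discards
A_I, hands its share over as A_I' and sends A_O' along the first wire. The second one holds the
initial memory, performs both isometries, keeps the intermediate memory inside its local operation
and sends C_I' along the second wire. The third one reads C_I' and discards C_O'. So the wires have
to transmit only A_O' and C_I', and ρ enters only through its trace. `exists_isLOSE_applyAdapter_eq`
assembles this.

The realization rests on uniqueness of purifications: the marginal conditions of a comb say that
each operator extends a marginal with a known purification, and `exists_isometry_of_partialTrace_eq`
turns each extension into an isometry on the purifying system.

LOSE adapters are non-signalling because trace preservation of a party's two channels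
(`IsLocalOperation.hasLocalMarginals`) makes the terms of the projector after the first cancel in
pairs, whatever the other parties and the shared state are (`nsProjector_eq_self`). -/

namespace CausalConnection

open Matrix

/-! ### Purifications and the circuit realization of combs -/

section Dilation

open scoped MatrixOrder Matrix.Norms.L2Operator

universe u

variable {X K L Y M : Type*}

/-- The Choi matrix of the channel from `K` to `Y` with Stinespring matrix `U` and environment
`M`; the rows of `U` are labelled by the input. -/
def stinespringChoi [Fintype M] (U : Matrix K (Y × M) ℂ) : Matrix (K × Y) (K × Y) ℂ :=
  Matrix.of fun p q => ∑ e, U p.1 (p.2, e) * star (U q.1 (q.2, e))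

theorem isChannel_stinespringChoi [Fintype K] [DecidableEq K] [Fintype Y] [Fintype M]
    {U : Matrix K (Y × M) ℂ} (hU : U * Uᴴ = 1) : IsChannel (stinespringChoi U) := by
  constructor
  · have h : stinespringChoi U =
        (Matrix.of fun (p : K × Y) (e : M) => U p.1 (p.2, e)) *
          (Matrix.of fun (p : K × Y) (e : M) => U p.1 (p.2, e))ᴴ := by
      ext p q
      simp [stinespringChoi, Matrix.mul_apply]
    rw [h]
    exact posSemidef_self_mul_conjTranspose _
  · rw [← hU]
    ext k k'
    simp [partialTrace, stinespringChoi, Matrix.mul_apply, Fintype.sum_prod_type]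

theorem _root_.Matrix.PosSemidef.partialTrace [Finite X] [Fintype Y]
    {P : Matrix (X × Y) (X × Y) ℂ} (hP : P.PosSemidef) : (partialTrace P).PosSemidef := by
  have h : CausalConnection.partialTrace P =
      ∑ y, P.submatrix (fun x => (x, y)) (fun x => (x, y)) := by
    ext x x'
    simp [CausalConnection.partialTrace, Matrix.sum_apply]
  rw [h]
  exact posSemidef_sum _ fun y _ => hP.submatrix _

theorem mul_conjTranspose_of_injective [Fintype L] [DecidableEq K] [DecidableEq L] {f : K → L}
    (hf : Function.Injective f) :
    (Matrix.of fun k l => if f k = l then (1 : ℂ) else 0) *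
      (Matrix.of fun k l => if f k = l then (1 : ℂ) else 0)ᴴ = 1 := by
  ext k k'
  simp [Matrix.mul_apply, Matrix.one_apply, hf.eq_iff, eq_comm]

/-- Hermitian matrices have a Hermitian pseudoinverse. -/
theorem exists_pseudoinverse [Fintype X] [DecidableEq X] {S : Matrix X X ℂ}
    (hS : S.IsHermitian) :
    ∃ T : Matrix X X ℂ, T.IsHermitian ∧ S * T * S = S ∧ T * S * T = T := by
  let D : Matrix X X ℂ := diagonal fun i => (hS.eigenvalues i : ℂ)
  -- The convention `0⁻¹ = 0` makes this the pseudoinverse of `D`, kernel included.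
  let E : Matrix X X ℂ := diagonal fun i => (hS.eigenvalues i : ℂ)⁻¹
  let O : Matrix X X ℂ := hS.eigenvectorUnitary
  have hO : Oᴴ * O = 1 := Unitary.coe_star_mul_self hS.eigenvectorUnitary
  have hSD : S = O * D * Oᴴ := by
    have := hS.spectral_theorem
    rw [Unitary.conjStarAlgAut_apply] at this
    exact this
  have key : ∀ F G : Matrix X X ℂ, (O * F * Oᴴ) * (O * G * Oᴴ) = O * (F * G) * Oᴴ := by
    intro F G
    calc (O * F * Oᴴ) * (O * G * Oᴴ) = O * F * (Oᴴ * O) * G * Oᴴ := by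
          simp only [Matrix.mul_assoc]
      _ = O * (F * G) * Oᴴ := by rw [hO]; simp only [Matrix.mul_assoc, Matrix.one_mul]
  refine ⟨O * E * Oᴴ, ?_, ?_, ?_⟩
  · have hE : Eᴴ = E := by
      simp only [E, diagonal_conjTranspose]
      congr 1
      ext i
      simp
    simp [IsHermitian, conjTranspose_mul, hE, Matrix.mul_assoc]
  · have h : D * E * D = D := by
      simp only [D, E, diagonal_mul_diagonal]
      congr 1
      ext i
      by_cases h : (hS.eigenvalues i : ℂ) = 0 <;> simp [h]
    rw [hSD, key, key, h]
  · have h : E * D * E = E := by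
      simp only [D, E, diagonal_mul_diagonal]
      congr 1
      ext i
      by_cases h : (hS.eigenvalues i : ℂ) = 0 <;> simp [h]
    rw [hSD, key, key, h]

/-- If `A Aᴴ = B Bᴴ`, then `B = A U` for a contraction `U`, whose defect `R` is annihilated by
`A`. -/
theorem exists_mul_eq_of_mul_conjTranspose_eq {K L : Type u} [Fintype X] [DecidableEq X]
    [Fintype K] [DecidableEq K] [Fintype L] {A : Matrix X K ℂ} {B : Matrix X L ℂ} (h : A * Aᴴ = B * Bᴴ) :
    ∃ (U : Matrix K L ℂ) (R : Matrix K K ℂ), A * U = B ∧ A * R = 0 ∧ U * Uᴴ + R * Rᴴ = 1 := by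
  obtain ⟨T, hT, hST, hTS⟩ := exists_pseudoinverse (isHermitian_mul_conjTranspose_self A)
  set S := A * Aᴴ with hS
  have hSh : Sᴴ = S := isHermitian_mul_conjTranspose_self A
  -- `S * T` is a projection onto the range of `S`, which contains the columns of `C`. The proof
  -- computes the Gram matrix of the difference and finds zero.
  have fixed : ∀ {J : Type u} [Fintype J] (C : Matrix X J ℂ), S = C * Cᴴ → S * T * C = C := by
    intro J _ C hC
    rw [← sub_eq_zero, ← self_mul_conjTranspose_eq_zero]
    have e : (S * T * C - C) * (S * T * C - C)ᴴ =
        S * T * (C * Cᴴ) * T * S - S * T * (C * Cᴴ) - (C * Cᴴ) * T * S + C * Cᴴ := by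
      simp only [conjTranspose_sub, conjTranspose_mul, hT.eq, hSh, Matrix.sub_mul,
        Matrix.mul_sub, Matrix.mul_assoc]
      abel
    rw [e, ← hC, hST, hST]
    abel
  have hA : S * T * A = A := fixed A hS
  have hB : S * T * B = B := fixed B h
  have hP : (Aᴴ * T * A) * (Aᴴ * T * A) = Aᴴ * T * A := by
    calc (Aᴴ * T * A) * (Aᴴ * T * A) = Aᴴ * (T * S * T) * A := by
          simp only [hS, Matrix.mul_assoc]
      _ = _ := by rw [hTS]
  -- `Aᴴ * T * A` is an orthogonal projection that equals `U * Uᴴ`; the defect `R` is the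
  -- complementary projection.
  refine ⟨Aᴴ * T * B, 1 - Aᴴ * T * A, ?_, ?_, ?_⟩
  · rw [← Matrix.mul_assoc, ← Matrix.mul_assoc, ← hS, hB]
  · rw [Matrix.mul_sub, ← Matrix.mul_assoc, ← Matrix.mul_assoc, ← hS, hA, Matrix.mul_one, sub_self]
  · have hU : (Aᴴ * T * B) * (Aᴴ * T * B)ᴴ = Aᴴ * T * A := by
      calc (Aᴴ * T * B) * (Aᴴ * T * B)ᴴ = Aᴴ * (T * (B * Bᴴ) * T) * A := by
            simp only [conjTranspose_mul, conjTranspose_conjTranspose, hT.eq, Matrix.mul_assoc]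
        _ = _ := by rw [← h, hTS]
    have hR : (1 - Aᴴ * T * A)ᴴ = 1 - Aᴴ * T * A := by
      simp only [conjTranspose_sub, conjTranspose_one, conjTranspose_mul,
        conjTranspose_conjTranspose, hT.eq, Matrix.mul_assoc]
    rw [hU, hR, Matrix.sub_mul, Matrix.mul_sub, Matrix.mul_sub, hP]
    simp

/-- Every purification `V` of the marginal of a positive operator `P` on `X ⊗ Y` extends to a
purification of `P` by an isometry acting on the purifying system only. -/
theorem exists_isometry_of_partialTrace_eq {X K Y : Type} [Fintype X] [DecidableEq X] [Fintype K]
    [DecidableEq K] [Fintype Y] [DecidableEq Y] [Nonempty Y] {P : Matrix (X × Y) (X × Y) ℂ}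
    (hP : P.PosSemidef) {V : Matrix X K ℂ} (hV : V * Vᴴ = partialTrace P) :
    ∃ (M : Type) (_ : Fintype M) (_ : DecidableEq M) (U : Matrix K (Y × M) ℂ), U * Uᴴ = 1 ∧
      ∀ x y x' y', P (x, y) (x', y') = ∑ e, (V * U) x (y, e) * star ((V * U) x' (y', e)) := by
  obtain ⟨Q, hQ⟩ := CStarAlgebra.nonneg_iff_eq_star_mul_self.mp hP.nonneg
  -- A square root of `P` is a purification of `P`; moving `Y` to the purifying side makes it a
  -- purification of the marginal, to be compared with `V`.
  let B : Matrix X (Y × (X × Y)) ℂ := Matrix.of fun x p => star (Q p.2 (x, p.1))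
  have hPB : ∀ x y x' y', P (x, y) (x', y') = ∑ e, B x (y, e) * star (B x' (y', e)) := by
    intro x y x' y'
    simp [hQ, B, Matrix.mul_apply, star_eq_conjTranspose]
  have hB : V * Vᴴ = B * Bᴴ := by
    rw [hV]
    ext x x'
    simp only [partialTrace, of_apply, hPB, Matrix.mul_apply, conjTranspose_apply,
      Fintype.sum_prod_type (α₁ := Y)]
  obtain ⟨U, R, hU, hR, hUR⟩ := exists_mul_eq_of_mul_conjTranspose_eq hB
  obtain ⟨y₀⟩ := ‹Nonempty Y›
  -- The contraction becomes an isometry once its defect `R` is sent to a second block of the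
  -- environment, with `Y` in the fixed state `y₀`. Since `V * R = 0`, this block never shows up in
  -- `V * U'`.
  let U' : Matrix K (Y × ((X × Y) ⊕ K)) ℂ := Matrix.of fun k p =>
    p.2.elim (fun e => U k (p.1, e)) (fun e => if p.1 = y₀ then R k e else 0)
  have hl : ∀ x y e, (V * U') x (y, Sum.inl e) = B x (y, e) := by
    intro x y e
    rw [← hU]
    simp [Matrix.mul_apply, U']
  have hr : ∀ x y e, (V * U') x (y, Sum.inr e) = 0 := by
    intro x y e
    by_cases hy : y = y₀
    · simpa [Matrix.mul_apply, U', hy] using congr_fun (congr_fun hR x) e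
    · simp [Matrix.mul_apply, U', hy]
  refine ⟨(X × Y) ⊕ K, inferInstance, inferInstance, U', ?_, ?_⟩
  · rw [← hUR]
    ext k k'
    simp only [Matrix.mul_apply, conjTranspose_apply, Matrix.add_apply,
      Fintype.sum_prod_type (α₁ := Y), Fintype.sum_sum_type, Finset.sum_add_distrib]
    congr 1
    rw [Finset.sum_eq_single y₀]
    · simp [U']
    · intro b _ hb
      simp [U', hb]
    · simp
  · intro x y x' y'
    simp only [Fintype.sum_sum_type, hl, hr, hPB]
    simp

/-- Realization of a comb by an initial pure state `V` on `A_I M₁`, an isometry `U₁` from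
`M₁ A_O` to `B_I M₂` and an isometry `U₂` from `M₂ B_O` to `C_I M₃`. -/
theorem IsOrderedComb.exists_realization {AI AO BI BO CI CO : Type}
    [Fintype AI] [Fintype AO] [Fintype BI] [Fintype BO] [Fintype CI]
    [DecidableEq AI] [DecidableEq AO] [DecidableEq BI] [DecidableEq BO] [DecidableEq CI]
    [DecidableEq CO] [Nonempty AO] [Nonempty BI] [Nonempty BO] [Nonempty CI] [Nonempty CO]
    {W : Matrix (TriIndex AI AO BI BO CI CO) (TriIndex AI AO BI BO CI CO) ℂ}
    (hW : IsOrderedComb W) :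
    ∃ (M₁ M₂ M₃ : Type) (_ : Fintype M₁) (_ : Fintype M₂) (_ : Fintype M₃)
      (_ : DecidableEq M₁) (_ : DecidableEq M₂)
      (V : Matrix AI M₁ ℂ) (U₁ : Matrix (M₁ × AO) (BI × M₂) ℂ)
      (U₂ : Matrix (M₂ × BO) (CI × M₃) ℂ),
      (V * Vᴴ).trace = 1 ∧ U₁ * U₁ᴴ = 1 ∧ U₂ * U₂ᴴ = 1 ∧
      ∀ aI aO bI bO cI cO aI' aO' bI' bO' cI' cO',
        W ((aI, aO), (bI, bO), (cI, cO)) ((aI', aO'), (bI', bO'), (cI', cO')) =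
          (∑ m₁, ∑ m₁', V aI m₁ * star (V aI' m₁') *
            ∑ m₂, ∑ m₂', U₁ (m₁, aO) (bI, m₂) * star (U₁ (m₁', aO') (bI', m₂')) *
              stinespringChoi U₂ ((m₂, bO), cI) ((m₂', bO'), cI')) *
            (1 : Matrix CO CO ℂ) cO cO' := by
  obtain ⟨hpos, W₃, W₂, W₁, h₃, h₂, h₁, htr⟩ := hW
  obtain ⟨o₃⟩ := ‹Nonempty CO›
  obtain ⟨o₂⟩ := ‹Nonempty BO›
  obtain ⟨o₁⟩ := ‹Nonempty AO›
  -- Fixing a diagonal label of the identity factor exhibits the smaller operator as a principal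
  -- submatrix; the same device gives `hp₂` and `hp₁`.
  have hp₃ : W₃.PosSemidef := by
    convert hpos.submatrix
      (fun p : ((AI × AO) × (BI × BO)) × CI => (p.1.1, p.1.2, (p.2, o₃)))
    ext p q
    simp [h₃]
  have hp₂ : W₂.PosSemidef := by
    convert hp₃.partialTrace.submatrix
      (fun p : (AI × AO) × BI => (p.1, (p.2, o₂)))
    ext p q
    simp [h₂]
  have hp₁ : W₁.PosSemidef := by
    convert hp₂.partialTrace.submatrix (fun p : AI => (p, o₁))
    ext p q
    simp [h₁]
  obtain ⟨Q, hQ⟩ := CStarAlgebra.nonneg_iff_eq_star_mul_self.mp hp₁.nonneg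
  have hV : Qᴴ * Qᴴᴴ = W₁ := by rw [hQ, conjTranspose_conjTranspose, star_eq_conjTranspose]
  generalize Qᴴ = V at hV
  -- The identity on A_O is purified by A_O itself, so the purifying system is the memory together
  -- with A_O, the input of the first isometry.
  have hV' : (V ⊗ₖ (1 : Matrix AO AO ℂ)) * (V ⊗ₖ (1 : Matrix AO AO ℂ))ᴴ = partialTrace W₂ := by
    rw [h₁, conjTranspose_kronecker, ← mul_kronecker_mul, hV]
    simp
  obtain ⟨M₂, _, _, U₁, hU₁, hWU₁⟩ := exists_isometry_of_partialTrace_eq hp₂ hV'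
  -- B_I now joins the visible systems, which leaves `M₂` as the purifying system for the next
  -- round.
  let V₂ : Matrix ((AI × AO) × BI) M₂ ℂ :=
    Matrix.of fun p e => ((V ⊗ₖ (1 : Matrix AO AO ℂ)) * U₁) p.1 (p.2, e)
  have hV₂ : V₂ * V₂ᴴ = W₂ := by
    ext p q
    rw [hWU₁]
    simp [V₂, Matrix.mul_apply (M := Matrix.of _)]
  let f : (((AI × AO) × BI) × BO) × CI → ((AI × AO) × (BI × BO)) × CI :=
    fun p => ((p.1.1.1, (p.1.1.2, p.1.2)), p.2)
  have hV₂' : (V₂ ⊗ₖ (1 : Matrix BO BO ℂ)) * (V₂ ⊗ₖ (1 : Matrix BO BO ℂ))ᴴ =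
      partialTrace (W₃.submatrix f f) := by
    rw [conjTranspose_kronecker, ← mul_kronecker_mul, hV₂]
    ext p q
    have := h₂ p.1.1 p.1.2 p.2 q.1.1 q.1.2 q.2
    simp only [partialTrace, of_apply] at this
    simp [partialTrace, f, this, kroneckerMap_apply]
  obtain ⟨M₃, _, _, U₂, hU₂, hWU₂⟩ := exists_isometry_of_partialTrace_eq (hp₃.submatrix f) hV₂'
  refine ⟨AI, M₂, M₃, inferInstance, inferInstance, inferInstance, inferInstance, inferInstance,
    V, U₁, U₂, by rw [hV, htr], hU₁, hU₂, ?_⟩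
  intro aI aO bI bO cI cO aI' aO' bI' bO' cI' cO'
  rw [h₃]
  congr 1
  have h := hWU₂ (((aI, aO), bI), bO) cI (((aI', aO'), bI'), bO') cI'
  have e : ∀ aI aO bI bO cI e, ((V₂ ⊗ₖ (1 : Matrix BO BO ℂ)) * U₂) (((aI, aO), bI), bO) (cI, e) =
      ∑ m₁, V aI m₁ * ∑ m₂, U₁ (m₁, aO) (bI, m₂) * U₂ (m₂, bO) (cI, e) := by
    intro aI aO bI bO cI e
    simp only [V₂, Matrix.mul_apply, Fintype.sum_prod_type, kroneckerMap_apply, Matrix.one_apply,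
      of_apply, mul_ite, mul_one, mul_zero, ite_mul, zero_mul, Finset.sum_ite_eq,
      Finset.mem_univ, if_true, Finset.sum_mul, Finset.mul_sum]
    rw [Finset.sum_comm]
    simp only [mul_assoc]
  simp only [e] at h
  refine Eq.trans h ?_
  simp only [stinespringChoi, of_apply, star_sum, star_mul', Finset.sum_mul_sum]
  simp only [Finset.sum_mul, Finset.mul_sum]
  rw [Finset.sum_comm]
  refine Finset.sum_congr rfl fun m₁ _ => ?_
  rw [Finset.sum_comm]
  refine Finset.sum_congr rfl fun m₁' _ => ?_
  conv_rhs => rw [Finset.sum_comm]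
  rw [Finset.sum_comm]
  refine Finset.sum_congr rfl fun m₂ _ => ?_
  rw [Finset.sum_comm]
  refine Finset.sum_congr rfl fun m₂' _ => ?_
  refine Finset.sum_congr rfl fun e _ => ?_
  ring

end Dilation

/-! ### Positivity of the link product -/

section Link

variable {X Y Z : Type*}

/-- The link product is a congruence of `F ⊗ₖ L`: the matrix `C` contracts the two copies of `Y`
with the unnormalized maximally entangled vector. -/
theorem _root_.Matrix.PosSemidef.linkProduct [Fintype X] [Fintype Y] [Fintype Z]
    {F : Matrix (X × Y) (X × Y) ℂ} {L : Matrix (Y × Z) (Y × Z) ℂ}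
    (hF : F.PosSemidef) (hL : L.PosSemidef) : (linkProduct F L).PosSemidef := by
  classical
  let C : Matrix (X × Z) ((X × Y) × (Y × Z)) ℂ := Matrix.of fun p q =>
    if p.1 = q.1.1 then if q.1.2 = q.2.1 then if p.2 = q.2.2 then 1 else 0 else 0 else 0
  have h : CausalConnection.linkProduct F L = C * (F ⊗ₖ L) * Cᴴ := by
    ext p q
    simp [linkProduct_apply, C, Matrix.mul_apply, Fintype.sum_prod_type, kroneckerMap_apply,
      apply_ite star, Finset.sum_ite_irrel]
    rw [Finset.sum_comm]
  rw [h]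
  exact (hF.kronecker hL).mul_mul_conjTranspose_same C

theorem linkAll_apply [Fintype Y] [Fintype Z] (ρ : Matrix Y Y ℂ)
    (L : Matrix (Y × Z) (Y × Z) ℂ) (z z' : Z) :
    linkAll ρ L z z' = ∑ y, ∑ y', ρ y y' * L (y, z) (y', z') := by
  simp [linkAll, linkProduct_apply]

theorem _root_.Matrix.PosSemidef.linkAll [Fintype Y] [Fintype Z] {ρ : Matrix Y Y ℂ}
    {L : Matrix (Y × Z) (Y × Z) ℂ} (hρ : ρ.PosSemidef) (hL : L.PosSemidef) :
    (linkAll ρ L).PosSemidef :=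
  ((hρ.submatrix _).linkProduct hL).submatrix _

end Link

/-! ### Marginals of local operations and the non-signalling projector -/

section NonSignalling

variable {T XI XO XI' XO' R ι : Type*}

/-- Tracing out the output `X_O` of `K` leaves an identity on `X_O'`, and tracing out `X_I'` as
well leaves an identity on the inputs `T` and `X_I`. -/
def HasLocalMarginals [Fintype XO] [Fintype XI'] [DecidableEq T] [DecidableEq XI]
    [DecidableEq XO'] (K : Matrix (T × ((XI × XO) × (XI' × XO')))
      (T × ((XI × XO) × (XI' × XO'))) ℂ) : Prop :=
  ∃ G : Matrix (T × XI × XI') (T × XI × XI') ℂ,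
    (∀ t xI xI' xO' t' yI yI' yO',
      ∑ xO, K (t, ((xI, xO), (xI', xO'))) (t', ((yI, xO), (yI', yO'))) =
        G (t, xI, xI') (t', yI, yI') * (1 : Matrix XO' XO' ℂ) xO' yO') ∧
    ∀ t xI t' yI, ∑ xI', G (t, xI, xI') (t', yI, xI') =
      (1 : Matrix T T ℂ) t t' * (1 : Matrix XI XI ℂ) xI yI

theorem HasLocalMarginals.sum_diag [Fintype XI] [Fintype XO] [Fintype XI'] [Fintype XO']
    [DecidableEq T] [DecidableEq XI] [DecidableEq XO']
    {K : Matrix (T × ((XI × XO) × (XI' × XO'))) (T × ((XI × XO) × (XI' × XO'))) ℂ}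
    (hK : HasLocalMarginals K) (t t' : T) :
    ∑ x, K (t, x) (t', x) =
      (1 : Matrix T T ℂ) t t' * (Fintype.card XI * Fintype.card XO' : ℂ) := by
  obtain ⟨G, h₁, h₂⟩ := hK
  have h : ∑ x, K (t, x) (t', x) = ∑ xI, ∑ xO', ∑ xI', ∑ xO,
      K (t, ((xI, xO), (xI', xO'))) (t', ((xI, xO), (xI', xO'))) := by
    simp only [Fintype.sum_prod_type]
    refine Finset.sum_congr rfl fun xI _ => ?_
    rw [Finset.sum_comm]
    conv_rhs => rw [Finset.sum_comm]
    refine Finset.sum_congr rfl fun xI' _ => ?_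
    rw [Finset.sum_comm]
  rw [h]
  simp only [h₁, Matrix.one_apply_eq, mul_one, h₂]
  simp only [Finset.sum_const, Finset.card_univ, nsmul_eq_mul]
  ring

theorem localOperation_apply {TI TO SI : Type*}
    [Fintype XI] [Fintype XO] [Fintype XI'] [Fintype XO'] [Fintype TI] [Fintype TO] [Fintype SI]
    (Λ : Matrix ((XI × TI) × (XI' × SI)) ((XI × TI) × (XI' × SI)) ℂ)
    (Γ : Matrix ((XO' × (SI × TO)) × XO) ((XO' × (SI × TO)) × XO) ℂ)
    (tI : TI) (tO : TO) (xI : XI) (xO : XO) (xI' : XI') (xO' : XO')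
    (uI : TI) (uO : TO) (yI : XI) (yO : XO) (yI' : XI') (yO' : XO') :
    localOperation Λ Γ ((tI, tO), ((xI, xO), (xI', xO'))) ((uI, uO), ((yI, yO), (yI', yO'))) =
      ∑ s, ∑ s', Λ ((xI, tI), (xI', s)) ((yI, uI), (yI', s')) *
        Γ ((xO', (s, tO)), xO) ((yO', (s', uO)), yO) := by
  simp [localOperation, linkProduct_apply]

theorem IsLocalOperation.posSemidef {TI TO : Type}
    [Fintype XI] [Fintype XO] [Fintype XI'] [Fintype XO'] [Fintype TI] [Fintype TO]
    [DecidableEq XI] [DecidableEq XO'] [DecidableEq TI] [DecidableEq TO]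
    {K : Matrix ((TI × TO) × ((XI × XO) × (XI' × XO')))
      ((TI × TO) × ((XI × XO) × (XI' × XO'))) ℂ} (hK : IsLocalOperation K) : K.PosSemidef := by
  obtain ⟨SI, _, _, Λ, Γ, hΛ, hΓ, rfl⟩ := hK
  exact ((hΛ.1.submatrix _).linkProduct (hΓ.1.submatrix _)).submatrix _

/-- Trace preservation of `Γ` leaves identities on X_O', on the memory and on the second share; the
one on the memory traces it out of `Λ`. Trace preservation of `Λ` then gives the second condition.
-/
theorem IsLocalOperation.hasLocalMarginals {TI TO : Type}
    [Fintype XI] [Fintype XO] [Fintype XI'] [Fintype XO'] [Fintype TI] [Fintype TO]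
    [DecidableEq XI] [DecidableEq XO'] [DecidableEq TI] [DecidableEq TO]
    {K : Matrix ((TI × TO) × ((XI × XO) × (XI' × XO')))
      ((TI × TO) × ((XI × XO) × (XI' × XO'))) ℂ} (hK : IsLocalOperation K) :
    HasLocalMarginals K := by
  obtain ⟨SI, _, _, Λ, Γ, hΛ, hΓ, rfl⟩ := hK
  have hΛ' : ∀ x y, ∑ z, Λ (x, z) (y, z) = (1 : Matrix (XI × TI) (XI × TI) ℂ) x y :=
    fun x y => congr_fun (congr_fun hΛ.2 x) y
  have hΓ' : ∀ x y, ∑ z, Γ (x, z) (y, z) =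
      (1 : Matrix (XO' × (SI × TO)) (XO' × (SI × TO)) ℂ) x y :=
    fun x y => congr_fun (congr_fun hΓ.2 x) y
  refine ⟨Matrix.of fun p q => (1 : Matrix TO TO ℂ) p.1.2 q.1.2 *
    ∑ s, Λ ((p.2.1, p.1.1), (p.2.2, s)) ((q.2.1, q.1.1), (q.2.2, s)), ?_, ?_⟩
  · rintro ⟨tI, tO⟩ xI xI' xO' ⟨uI, uO⟩ yI yI' yO'
    simp only [localOperation_apply]
    rw [Finset.sum_comm]
    have : ∀ s, ∑ xO, ∑ s', Λ ((xI, tI), (xI', s)) ((yI, uI), (yI', s')) *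
        Γ ((xO', (s, tO)), xO) ((yO', (s', uO)), xO) =
        Λ ((xI, tI), (xI', s)) ((yI, uI), (yI', s)) *
          ((1 : Matrix TO TO ℂ) tO uO * (1 : Matrix XO' XO' ℂ) xO' yO') := by
      intro s
      rw [Finset.sum_comm]
      simp only [← Finset.mul_sum, hΓ']
      rw [Finset.sum_eq_single s]
      · by_cases h₁ : xO' = yO' <;> by_cases h₂ : tO = uO <;> simp [Matrix.one_apply, h₁, h₂]
      · intro s' _ hs
        simp [hs.symm]
      · simp
    simp only [this, ← Finset.sum_mul, of_apply]
    ring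
  · rintro ⟨tI, tO⟩ xI ⟨uI, uO⟩ yI
    have := hΛ' (xI, tI) (yI, uI)
    rw [Fintype.sum_prod_type] at this
    change ∑ xI', (1 : Matrix TO TO ℂ) tO uO *
      ∑ s, Λ ((xI, tI), (xI', s)) ((yI, uI), (xI', s)) = _
    rw [← Finset.mul_sum, this]
    by_cases h₁ : xI = yI <;> by_cases h₂ : tO = uO <;> by_cases h₃ : tI = uI <;>
      simp [Matrix.one_apply, h₁, h₂, h₃]

theorem traceReplace_symm_apply {S : Type*} [Fintype S] [DecidableEq S] (e : ι ≃ S × R)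
    (M : Matrix ι ι ℂ) (s : S) (r : R) (s' : S) (r' : R) :
    traceReplace e M (e.symm (s, r)) (e.symm (s', r')) =
      (1 : Matrix S S ℂ) s s' *
        ((Fintype.card S : ℂ)⁻¹ * ∑ u, M (e.symm (u, r)) (e.symm (u, r'))) := by
  simp [traceReplace, Matrix.one_apply]

theorem traceReplace_eq_self {S : Type*} [Fintype S] [DecidableEq S] (e : ι ≃ S × R)
    {M : Matrix ι ι ℂ} {N : Matrix R R ℂ}
    (h : ∀ s r s' r', M (e.symm (s, r)) (e.symm (s', r')) = (1 : Matrix S S ℂ) s s' * N r r') :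
    traceReplace e M = M := by
  ext i j
  have : Nonempty S := ⟨(e i).1⟩
  have hij := h (e i).1 (e i).2 (e j).1 (e j).2
  simp only [Prod.mk.eta, Equiv.symm_apply_apply] at hij
  rw [hij]
  by_cases hs : (e i).1 = (e j).1 <;> simp [traceReplace, h, hs, Matrix.one_apply]

/-- After X_O is replaced by white noise, replacing X_O' changes nothing by `h₁`; after X_I' is
replaced too, replacing X_I changes nothing by `h₂`. So the four correction terms of the projector
cancel in two pairs. -/
theorem nsProjector_eq_self [Fintype XI] [Fintype XO] [Fintype XI'] [Fintype XO']
    [DecidableEq XI] [DecidableEq XO] [DecidableEq XI'] [DecidableEq XO']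
    (e : ι ≃ ((XI × XO) × (XI' × XO')) × R) {Υ : Matrix ι ι ℂ}
    {G : Matrix (XI × XI' × R) (XI × XI' × R) ℂ} {H : Matrix R R ℂ}
    (h₁ : ∀ xI xI' xO' r yI yI' yO' r',
      ∑ xO, Υ (e.symm (((xI, xO), (xI', xO')), r)) (e.symm (((yI, xO), (yI', yO')), r')) =
        G (xI, xI', r) (yI, yI', r') * (1 : Matrix XO' XO' ℂ) xO' yO')
    (h₂ : ∀ xI r yI r', ∑ xI', G (xI, xI', r) (yI, xI', r') =
      (1 : Matrix XI XI ℂ) xI yI * H r r') :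
    nsProjector e Υ = Υ := by
  have e₁ : ∀ xI xO xI' xO' r yI yO yI' yO' r',
      traceReplace (e.trans splitO) Υ (e.symm (((xI, xO), (xI', xO')), r))
        (e.symm (((yI, yO), (yI', yO')), r')) =
      (1 : Matrix XO' XO' ℂ) xO' yO' * ((Fintype.card XO : ℂ)⁻¹ *
        (1 : Matrix XO XO ℂ) xO yO * G (xI, xI', r) (yI, yI', r')) := by
    intro xI xO xI' xO' r yI yO yI' yO' r'
    refine (traceReplace_symm_apply (e.trans splitO) Υ xO (xI, xI', xO', r) yO
      (yI, yI', yO', r')).trans ?_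
    have : ∑ u, Υ ((e.trans splitO).symm (u, (xI, xI', xO', r)))
        ((e.trans splitO).symm (u, (yI, yI', yO', r'))) = _ := h₁ xI xI' xO' r yI yI' yO' r'
    rw [this]
    ring
  have e₂ : traceReplace (e.trans splitO') (traceReplace (e.trans splitO) Υ) =
      traceReplace (e.trans splitO) Υ := by
    refine traceReplace_eq_self _ (N := Matrix.of fun p q => (Fintype.card XO : ℂ)⁻¹ *
        (1 : Matrix XO XO ℂ) p.2.1 q.2.1 * G (p.1, p.2.2.1, p.2.2.2) (q.1, q.2.2.1, q.2.2.2)) ?_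
    rintro s ⟨xI, xO, xI', r⟩ s' ⟨yI, yO, yI', r'⟩
    simp [splitO', e₁]
  have e₃ : traceReplace (e.trans splitI) (traceReplace (e.trans splitI')
      (traceReplace (e.trans splitO) Υ)) = traceReplace (e.trans splitI')
      (traceReplace (e.trans splitO) Υ) := by
    refine traceReplace_eq_self _ (N := Matrix.of fun p q =>
      (1 : Matrix XI' XI' ℂ) p.2.1 q.2.1 * (Fintype.card XI' : ℂ)⁻¹ *
        ((1 : Matrix XO' XO' ℂ) p.2.2.1 q.2.2.1 * ((Fintype.card XO : ℂ)⁻¹ *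
          (1 : Matrix XO XO ℂ) p.1 q.1)) * H p.2.2.2 q.2.2.2) ?_
    rintro s ⟨xO, xI', xO', r⟩ s' ⟨yO, yI', yO', r'⟩
    refine (traceReplace_symm_apply (e.trans splitI') _ xI' (s, xO, xO', r) yI'
      (s', yO, yO', r')).trans ?_
    have : ∑ u, traceReplace (e.trans splitO) Υ ((e.trans splitI').symm (u, (s, xO, xO', r)))
        ((e.trans splitI').symm (u, (s', yO, yO', r'))) =
        ∑ u, (1 : Matrix XO' XO' ℂ) xO' yO' * ((Fintype.card XO : ℂ)⁻¹ *
        (1 : Matrix XO XO ℂ) xO yO * G (s, u, r) (s', u, r')) :=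
      Finset.sum_congr rfl fun u _ => e₁ s xO u xO' r s' yO u yO' r'
    rw [this, ← Finset.mul_sum, ← Finset.mul_sum, h₂]
    simp only [of_apply]
    ring
  simp only [nsProjector, e₂, e₃]
  abel

/-- Seen from one party, an adapter is a linear combination of blocks of `K` whose coefficients do
not involve that party's labels, so the marginal conditions carry over by linearity. -/
theorem nsProjector_eq_self_of_hasLocalMarginals {S : Type*} [Fintype S]
    [Fintype XI] [Fintype XO] [Fintype XI'] [Fintype XO'] [DecidableEq T]
    [DecidableEq XI] [DecidableEq XO] [DecidableEq XI'] [DecidableEq XO']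
    (e : ι ≃ ((XI × XO) × (XI' × XO')) × R) {Υ : Matrix ι ι ℂ}
    {K : Matrix (T × ((XI × XO) × (XI' × XO'))) (T × ((XI × XO) × (XI' × XO'))) ℂ}
    (hK : HasLocalMarginals K) (π : S → T) (c : S → S → R → R → ℂ)
    (h : ∀ x r x' r', Υ (e.symm (x, r)) (e.symm (x', r')) =
      ∑ s, ∑ s', c s s' r r' * K (π s, x) (π s', x')) :
    nsProjector e Υ = Υ := by
  obtain ⟨G, h₁, h₂⟩ := hK
  refine nsProjector_eq_self e
    (G := Matrix.of fun p q => ∑ s, ∑ s', c s s' p.2.2 q.2.2 *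
      G (π s, p.1, p.2.1) (π s', q.1, q.2.1))
    (H := Matrix.of fun r r' => ∑ s, ∑ s', c s s' r r' * (1 : Matrix T T ℂ) (π s) (π s')) ?_ ?_
  · intro xI xI' xO' r yI yI' yO' r'
    simp only [h, of_apply, Finset.sum_mul]
    rw [Finset.sum_comm]
    refine Finset.sum_congr rfl fun s _ => ?_
    rw [Finset.sum_comm]
    refine Finset.sum_congr rfl fun s' _ => ?_
    rw [← Finset.mul_sum, h₁, mul_assoc]
  · intro xI r yI r'
    simp only [of_apply, Finset.mul_sum]
    rw [Finset.sum_comm]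
    refine Finset.sum_congr rfl fun s _ => ?_
    rw [Finset.sum_comm]
    refine Finset.sum_congr rfl fun s' _ => ?_
    rw [← Finset.mul_sum, h₂]
    ring

end NonSignalling

/-! ### LOSE adapters are non-signalling -/

section LOSE

variable {AI AO BI BO CI CO AI' AO' BI' BO' CI' CO' : Type*}

/-- Adapters from local operations and shared entanglement are non-signalling. -/
theorem IsLOSE.isNonSignalling
    [Fintype AI] [Fintype AO] [Fintype BI] [Fintype BO] [Fintype CI] [Fintype CO]
    [Fintype AI'] [Fintype AO'] [Fintype BI'] [Fintype BO'] [Fintype CI'] [Fintype CO']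
    [DecidableEq AI] [DecidableEq AO] [DecidableEq BI] [DecidableEq BO] [DecidableEq CI]
    [DecidableEq CO]
    [DecidableEq AI'] [DecidableEq AO'] [DecidableEq BI'] [DecidableEq BO'] [DecidableEq CI']
    [DecidableEq CO']
    {Υ : Matrix (AdapterIndex AI AO BI BO CI CO AI' AO' BI' BO' CI' CO')
      (AdapterIndex AI AO BI BO CI CO AI' AO' BI' BO' CI' CO') ℂ} (h : IsLOSE Υ) :
    IsNonSignalling Υ := by
  obtain ⟨TAI, TAO, TBI, TBO, TCI, TCO, _, _, _, _, _, _, _, _, _, _, _, _, τ, KA, KB, KC, hτ,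
    hA, hB, hC, rfl⟩ := h
  have mA := hA.hasLocalMarginals
  have mB := hB.hasLocalMarginals
  have mC := hC.hasLocalMarginals
  refine ⟨hτ.1.linkAll ((hA.posSemidef.kronecker (hB.posSemidef.kronecker
    hC.posSemidef)).submatrix _), ?_, ?_⟩
  -- Each projector fixes the adapter separately; the coefficients collect the shared state and the
  -- local operations of the other two parties.
  · rw [nsProjector_eq_self_of_hasLocalMarginals splitC mC (fun t => t.2.2)
        (fun t t' r r' => τ t t' * (KA (t.1, (r.1, r.2.2.1)) (t'.1, (r'.1, r'.2.2.1)) *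
          KB (t.2.1, (r.2.1, r.2.2.2)) (t'.2.1, (r'.2.1, r'.2.2.2)))),
      nsProjector_eq_self_of_hasLocalMarginals splitB mB (fun t => t.2.1)
        (fun t t' r r' => τ t t' * (KA (t.1, (r.1, r.2.2.1)) (t'.1, (r'.1, r'.2.2.1)) *
          KC (t.2.2, (r.2.1, r.2.2.2)) (t'.2.2, (r'.2.1, r'.2.2.2)))),
      nsProjector_eq_self_of_hasLocalMarginals splitA mA (fun t => t.1)
        (fun t t' r r' => τ t t' * (KB (t.2.1, (r.1, r.2.2.1)) (t'.2.1, (r'.1, r'.2.2.1)) *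
          KC (t.2.2, (r.2.1, r.2.2.2)) (t'.2.2, (r'.2.1, r'.2.2.2))))]
    all_goals
      rintro ⟨a, a'⟩ ⟨b, c, b', c'⟩ ⟨u, u'⟩ ⟨v, w, v', w'⟩
      rw [linkAll_apply]
      refine Finset.sum_congr rfl fun t _ => Finset.sum_congr rfl fun t' _ => ?_
      simp only [tensorLocal, splitA, splitB, splitC, Equiv.coe_fn_symm_mk, submatrix_apply,
        kroneckerMap_apply]
      ring
  · have key : (linkAll τ (tensorLocal KA KB KC)).trace = ∑ t, ∑ t', τ t t' *
        ((∑ a, KA (t.1, a) (t'.1, a)) * ((∑ b, KB (t.2.1, b) (t'.2.1, b)) *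
          ∑ c, KC (t.2.2, c) (t'.2.2, c))) := by
      simp only [trace, diag_apply, linkAll_apply]
      rw [Finset.sum_comm]
      refine Finset.sum_congr rfl fun t _ => ?_
      rw [Finset.sum_comm]
      refine Finset.sum_congr rfl fun t' _ => ?_
      rw [← Finset.mul_sum, Finset.sum_mul_sum, ← Fintype.sum_prod_type', Finset.sum_mul_sum,
        ← Fintype.sum_prod_type']
      congr 1
      refine Fintype.sum_equiv ⟨fun z => ((z.1.1, z.2.1), (z.1.2.1, z.2.2.1), (z.1.2.2, z.2.2.2)),
        fun z => ((z.1.1, z.2.1.1, z.2.2.1), (z.1.2, z.2.1.2, z.2.2.2)), fun _ => rfl,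
        fun _ => rfl⟩ _ _ fun z => ?_
      rfl
    rw [key]
    simp only [mA.sum_diag, mB.sum_diag, mC.sum_diag]
    have : ∀ t, ∑ t', τ t t' * ((1 : Matrix (TAI × TAO) (TAI × TAO) ℂ) t.1 t'.1 *
        (Fintype.card AI * Fintype.card AO' : ℂ) *
        ((1 : Matrix (TBI × TBO) (TBI × TBO) ℂ) t.2.1 t'.2.1 *
          (Fintype.card BI * Fintype.card BO' : ℂ) *
        ((1 : Matrix (TCI × TCO) (TCI × TCO) ℂ) t.2.2 t'.2.2 *
          (Fintype.card CI * Fintype.card CO' : ℂ)))) =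
        τ t t * (Fintype.card AI * Fintype.card AO' * (Fintype.card BI * Fintype.card BO') *
          (Fintype.card CI * Fintype.card CO')) := by
      intro t
      -- Off the diagonal of `τ`, at least one of the three identity factors vanishes; what remains
      -- is the trace of `τ` times the dimensions.
      rw [Finset.sum_eq_single t]
      · simp only [Matrix.one_apply_eq]
        ring
      · rintro ⟨t₁, t₂, t₃⟩ _ ht
        have : ¬ (t.1 = t₁ ∧ t.2.1 = t₂ ∧ t.2.2 = t₃) := by
          rintro ⟨rfl, rfl, rfl⟩
          exact ht rfl
        simp only [Matrix.one_apply]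
        by_cases h₁ : t.1 = t₁ <;> by_cases h₂ : t.2.1 = t₂ <;> by_cases h₃ : t.2.2 = t₃ <;>
          simp_all
      · simp
    simp only [this, ← Finset.sum_mul]
    have htr : ∑ t, τ t t = 1 := hτ.2
    rw [htr, one_mul]

end LOSE

/-! ### The process with two identity wires -/

section FullySignalling

variable {AI M N CO : Type*}

theorem posSemidef_phiPlus [Fintype M] [DecidableEq M] : (phiPlus M).PosSemidef := by
  have h : phiPlus M = vecMulVec (fun p : M × M => if p.1 = p.2 then (1 : ℂ) else 0)
      (star fun p : M × M => if p.1 = p.2 then (1 : ℂ) else 0) := by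
    ext p q
    by_cases h₁ : p.1 = p.2 <;> by_cases h₂ : q.1 = q.2 <;>
      simp [phiPlus, vecMulVec_apply, h₁, h₂]
  rw [h]
  exact posSemidef_vecMulVec_self_star _

/-- Each marginal condition comes down to the fact that tracing out one half of Φ⁺ leaves the
identity on the other half. -/
theorem isOrderedComb_fullySignalling [Fintype AI] [Fintype M] [Fintype N] [Fintype CO]
    [DecidableEq M] [DecidableEq N] [DecidableEq CO] {ρ : Matrix AI AI ℂ} (hρ : IsState ρ) :
    IsOrderedComb (fullySignalling ρ : Matrix (TriIndex AI M M N N CO)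
      (TriIndex AI M M N N CO) ℂ) := by
  refine ⟨?_, Matrix.of fun p q => ρ p.1.1.1 q.1.1.1 *
      phiPlus M (p.1.1.2, p.1.2.1) (q.1.1.2, q.1.2.1) * phiPlus N (p.1.2.2, p.2) (q.1.2.2, q.2),
    Matrix.of fun p q => ρ p.1.1 q.1.1 * phiPlus M (p.1.2, p.2) (q.1.2, q.2), ρ, ?_, ?_, ?_, hρ.2⟩
  · have h : (fullySignalling ρ : Matrix (TriIndex AI M M N N CO) (TriIndex AI M M N N CO) ℂ) =
        ((ρ ⊗ₖ phiPlus M) ⊗ₖ (phiPlus N ⊗ₖ (1 : Matrix CO CO ℂ))).submatrix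
          (fun p => ((p.1.1, (p.1.2, p.2.1.1)), ((p.2.1.2, p.2.2.1), p.2.2.2)))
          (fun p => ((p.1.1, (p.1.2, p.2.1.1)), ((p.2.1.2, p.2.2.1), p.2.2.2))) := by
      ext p q
      simp only [fullySignalling, of_apply, submatrix_apply, kroneckerMap_apply]
      ring
    rw [h]
    exact ((hρ.1.kronecker posSemidef_phiPlus).kronecker
      (posSemidef_phiPlus.kronecker PosSemidef.one)).submatrix _
  · intros
    rfl
  · rintro a bI bO a' bI' bO'
    simp only [partialTrace, of_apply, ← Finset.mul_sum]
    congr 1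
    simp [phiPlus, ite_and, Matrix.one_apply, eq_comm]
  · ext p q
    simp only [partialTrace, of_apply, ← Finset.mul_sum, kroneckerMap_apply]
    congr 1
    simp [phiPlus, ite_and, Matrix.one_apply, eq_comm]

/-- Linking `W^{A → B → C}` with a product of three operators identifies `A_O` with `B_I` and
`B_O` with `C_I`. -/
theorem sum_fullySignalling_mul [Fintype AI] [Fintype M] [Fintype N] [Fintype CO]
    [DecidableEq M] [DecidableEq N] [DecidableEq CO] (ρ : Matrix AI AI ℂ)
    (FA : AI × M → AI × M → ℂ) (FB : M × N → M × N → ℂ) (FC : N × CO → N × CO → ℂ) :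
    ∑ w, ∑ w', (fullySignalling ρ : Matrix (TriIndex AI M M N N CO)
        (TriIndex AI M M N N CO) ℂ) w w' *
        (FA w.1 w'.1 * (FB w.2.1 w'.2.1 * FC w.2.2 w'.2.2)) =
      ∑ b, ∑ b', (∑ a, ∑ a', ρ a a' * FA (a, b) (a', b')) *
        ∑ c, ∑ c', FB (b, c) (b', c') * ∑ o, FC (c, o) (c', o) := by
  have collapse : ∀ φ : TriIndex AI M M N N CO → ℂ,
      ∑ w, (if w.1.2 = w.2.1.1 then if w.2.1.2 = w.2.2.1 then φ w else 0 else 0) =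
        ∑ a, ∑ b, ∑ c, ∑ o, φ ((a, b), (b, c), (c, o)) := by
    intro φ
    simp [Fintype.sum_prod_type, Finset.sum_ite_irrel]
  have hW : ∀ w w', (fullySignalling ρ : Matrix (TriIndex AI M M N N CO)
        (TriIndex AI M M N N CO) ℂ) w w' *
        (FA w.1 w'.1 * (FB w.2.1 w'.2.1 * FC w.2.2 w'.2.2)) =
      if w.1.2 = w.2.1.1 then if w.2.1.2 = w.2.2.1 then
        (if w'.1.2 = w'.2.1.1 then if w'.2.1.2 = w'.2.2.1 then
          ρ w.1.1 w'.1.1 * (1 : Matrix CO CO ℂ) w.2.2.2 w'.2.2.2 *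
            (FA w.1 w'.1 * (FB w.2.1 w'.2.1 * FC w.2.2 w'.2.2)) else 0 else 0)
        else 0 else 0 := by
    intro w w'
    by_cases h₁ : w.1.2 = w.2.1.1 <;> by_cases h₂ : w.2.1.2 = w.2.2.1 <;>
      by_cases h₃ : w'.1.2 = w'.2.1.1 <;> by_cases h₄ : w'.2.1.2 = w'.2.2.1 <;>
      simp [fullySignalling, phiPlus, h₁, h₂, h₃, h₄]
  have inner : ∀ w, ∑ w', (fullySignalling ρ : Matrix (TriIndex AI M M N N CO)
        (TriIndex AI M M N N CO) ℂ) w w' *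
        (FA w.1 w'.1 * (FB w.2.1 w'.2.1 * FC w.2.2 w'.2.2)) =
      if w.1.2 = w.2.1.1 then if w.2.1.2 = w.2.2.1 then
        ∑ a', ∑ b', ∑ c', ρ w.1.1 a' *
          (FA w.1 (a', b') * (FB w.2.1 (b', c') * FC w.2.2 (c', w.2.2.2))) else 0 else 0 := by
    intro w
    simp only [hW, Finset.sum_ite_irrel, Finset.sum_const_zero, collapse]
    simp [Matrix.one_apply]
  simp only [inner, collapse]
  -- Both sides become single sums over product types, so that reordering seven summations is one
  -- bijection of index sets.
  have hL : ∑ a, ∑ b, ∑ c, ∑ o, ∑ a', ∑ b', ∑ c', ρ a a' *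
      (FA (a, b) (a', b') * (FB (b, c) (b', c') * FC (c, o) (c', o))) =
      ∑ q : AI × M × N × CO × AI × M × N, ρ q.1 q.2.2.2.2.1 *
        (FA (q.1, q.2.1) (q.2.2.2.2.1, q.2.2.2.2.2.1) *
          (FB (q.2.1, q.2.2.1) (q.2.2.2.2.2.1, q.2.2.2.2.2.2) *
            FC (q.2.2.1, q.2.2.2.1) (q.2.2.2.2.2.2, q.2.2.2.1))) := by
    simp only [Fintype.sum_prod_type]
  have hR : ∑ b, ∑ b', (∑ a, ∑ a', ρ a a' * FA (a, b) (a', b')) *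
        ∑ c, ∑ c', FB (b, c) (b', c') * ∑ o, FC (c, o) (c', o) =
      ∑ q : M × M × AI × AI × N × N × CO, ρ q.2.2.1 q.2.2.2.1 *
        FA (q.2.2.1, q.1) (q.2.2.2.1, q.2.1) *
          (FB (q.1, q.2.2.2.2.1) (q.2.1, q.2.2.2.2.2.1) *
            FC (q.2.2.2.2.1, q.2.2.2.2.2.2) (q.2.2.2.2.2.1, q.2.2.2.2.2.2)) := by
    simp only [Fintype.sum_prod_type, Finset.sum_mul]
    simp only [Finset.mul_sum]
  rw [hL, hR]
  refine Fintype.sum_equiv ⟨fun q => (q.2.1, q.2.2.2.2.2.1, q.1, q.2.2.2.2.1, q.2.2.1,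
      q.2.2.2.2.2.2, q.2.2.2.1), fun q => (q.2.2.1, q.1, q.2.2.2.2.1, q.2.2.2.2.2.2, q.2.2.2.1,
      q.2.1, q.2.2.2.2.2.1), fun _ => rfl, fun _ => rfl⟩ _ _ fun q => ?_
  simp only [Equiv.coe_fn_mk]
  ring

end FullySignalling

/-! ### The local operations of the three parties -/

section LocalOperations

variable {K L Y E : Type*}

/-- The Stinespring matrix that maps the basis vector `k` to the basis vector `φ k`. -/
def basisMap [DecidableEq L] (φ : K → L) : Matrix K L ℂ :=
  Matrix.of fun k l => if φ k = l then 1 else 0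

theorem basisMap_mul_conjTranspose [Fintype L] [DecidableEq K] [DecidableEq L] {φ : K → L}
    (hφ : Function.Injective φ) : basisMap φ * (basisMap φ)ᴴ = 1 :=
  mul_conjTranspose_of_injective hφ

theorem basisMap_mul_apply {J : Type*} [Fintype L] [DecidableEq L] (φ : K → L) (A : Matrix L J ℂ)
    (k : K) (j : J) : (basisMap φ * A) k j = A (φ k) j := by
  simp [basisMap, Matrix.mul_apply]

theorem stinespringChoi_basisMap [Fintype E] [DecidableEq E] [DecidableEq Y] (φ : K → Y × E)
    (k : K) (y : Y) (k' : K) (y' : Y) :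
    stinespringChoi (basisMap φ) (k, y) (k', y') =
      if (φ k).1 = y ∧ (φ k').1 = y' ∧ (φ k).2 = (φ k').2 then 1 else 0 := by
  by_cases h₁ : (φ k).1 = y <;> by_cases h₂ : (φ k').1 = y' <;>
    simp [stinespringChoi, basisMap, Prod.ext_iff, ite_and, h₁, h₂, eq_comm (a := (φ k').2)]

/-- Rows are inputs, so `A * B` is `A` followed by `B`: isometries compose. -/
theorem mul_conjTranspose_mul_self {J : Type*} [Fintype L] [Fintype J] [DecidableEq K]
    [DecidableEq L] {A : Matrix K L ℂ} {B : Matrix L J ℂ} (hA : A * Aᴴ = 1) (hB : B * Bᴴ = 1) :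
    (A * B) * (A * B)ᴴ = 1 := by
  rw [conjTranspose_mul, Matrix.mul_assoc, ← Matrix.mul_assoc B, hB, Matrix.one_mul, hA]

/-- An injection `f` has a left inverse that becomes injective once an environment is added. -/
theorem exists_dilated_retraction [Nonempty K] {f : K → L} (hf : Function.Injective f) :
    ∃ r : L → K × Option L, Function.Injective r ∧ ∀ k, r (f k) = (k, none) := by
  classical
  -- Outside the range of `f` the value of `Function.invFun` is arbitrary; recording `l` itself in
  -- the environment restores injectivity.
  refine ⟨fun l => if l ∈ Set.range f then (Function.invFun f l, none)
    else (Function.invFun f l, some l), ?_, ?_⟩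
  · intro l l' h
    by_cases h₁ : l ∈ Set.range f <;> by_cases h₂ : l' ∈ Set.range f
    · simp only [h₁, h₂, if_true, Prod.mk.injEq, and_true] at h
      rw [← Function.invFun_eq h₁, ← Function.invFun_eq h₂, h]
    all_goals simp_all
  · intro k
    simp [Function.leftInverse_invFun hf k]

variable {AI M N CO AI' AO' BI' BO' CI' CO' M₁ M₂ M₃ : Type}

/-- The first party discards `A_I`, puts its share of the state into `A_I'` and embeds `A_O'`
into `A_O`. -/
theorem exists_first_localOperation [Fintype AI] [Fintype M] [Fintype AI'] [Fintype AO']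
    [DecidableEq AI] [DecidableEq M] [DecidableEq AI'] [DecidableEq AO'] {f : AO' → M}
    (hf : Function.Injective f) :
    ∃ K : Matrix ((AI' × Unit) × ((AI × M) × (AI' × AO')))
        ((AI' × Unit) × ((AI × M) × (AI' × AO'))) ℂ,
      IsLocalOperation K ∧ ∀ t a b aI' aO' u a₁ b₁ aI₁' aO₁',
        K ((t, ()), ((a, b), (aI', aO'))) ((u, ()), ((a₁, b₁), (aI₁', aO₁'))) =
          if a = a₁ then if t = aI' then if u = aI₁' then if f aO' = b then if f aO₁' = b₁ then 1
            else 0 else 0 else 0 else 0 else 0 := by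
  -- The last factor is the environment: putting A_I there discards it.
  let φ : AI × AI' → (AI' × Unit) × AI := fun p => ((p.2, ()), p.1)
  let ψ : AO' × (Unit × Unit) → M × Unit := fun p => (f p.1, ())
  have hφ : Function.Injective φ := by
    rintro ⟨a, t⟩ ⟨a', t'⟩ h
    simp_all [φ]
  have hψ : Function.Injective ψ := by
    rintro ⟨a, ⟨⟩, ⟨⟩⟩ ⟨a', ⟨⟩, ⟨⟩⟩ h
    simpa [ψ, hf.eq_iff] using h
  refine ⟨_, ⟨Unit, inferInstance, inferInstance, _, _,
    isChannel_stinespringChoi (basisMap_mul_conjTranspose hφ),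
    isChannel_stinespringChoi (basisMap_mul_conjTranspose hψ), rfl⟩, ?_⟩
  intro t a b aI' aO' u a₁ b₁ aI₁' aO₁'
  simp only [localOperation_apply, stinespringChoi_basisMap, φ, ψ]
  by_cases h₁ : a = a₁ <;> by_cases h₂ : t = aI' <;> by_cases h₃ : u = aI₁' <;>
    simp [h₁, h₂, h₃, ite_and]

/-- The second party restricts `B_I` to `A_O'`, applies the isometries `U₁` and `U₂` and embeds
`C_I'` into `B_O`. -/
theorem exists_second_localOperation [Fintype M] [Fintype N] [Fintype AO'] [Fintype BI']
    [Fintype BO'] [Fintype CI'] [Fintype M₁] [Fintype M₂] [Fintype M₃]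
    [DecidableEq M] [DecidableEq N] [DecidableEq AO'] [DecidableEq BI'] [DecidableEq BO']
    [DecidableEq CI'] [DecidableEq M₁] [DecidableEq M₂] [Nonempty AO']
    {f : AO' → M} (hf : Function.Injective f) {g : CI' → N} (hg : Function.Injective g)
    {U₁ : Matrix (M₁ × AO') (BI' × M₂) ℂ} (hU₁ : U₁ * U₁ᴴ = 1)
    {U₂ : Matrix (M₂ × BO') (CI' × M₃) ℂ} (hU₂ : U₂ * U₂ᴴ = 1) :
    ∃ K : Matrix ((M₁ × Unit) × ((M × N) × (BI' × BO')))
        ((M₁ × Unit) × ((M × N) × (BI' × BO'))) ℂ,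
      IsLocalOperation K ∧ ∀ m₁ a n bI' bO' m₁' a' n' bI₁' bO₁',
        K ((m₁, ()), ((f a, n), (bI', bO'))) ((m₁', ()), ((f a', n'), (bI₁', bO₁'))) =
          ∑ c, ∑ c', if g c = n then if g c' = n' then
            ∑ m₂, ∑ m₂', U₁ (m₁, a) (bI', m₂) * star (U₁ (m₁', a') (bI₁', m₂')) *
              stinespringChoi U₂ ((m₂, bO'), c) ((m₂', bO₁'), c') else 0 else 0 := by
  classical
  obtain ⟨r, hr, hrf⟩ := exists_dilated_retraction hf
  let φ : M × M₁ → (M₁ × AO') × Option M := fun p => ((p.2, (r p.1).1), (r p.1).2)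
  have hφ : Function.Injective φ := by
    rintro ⟨b, m⟩ ⟨b', m'⟩ h
    simp only [φ, Prod.mk.injEq] at h
    rw [hr (Prod.ext h.1.2 h.2), h.1.1]
  let ψ : CI' × M₃ → N × M₃ := fun p => (g p.1, p.2)
  have hψ : Function.Injective ψ := by
    rintro ⟨c, m⟩ ⟨c', m'⟩ h
    simpa [ψ, hg.eq_iff] using h
  let s : BO' × (M₂ × Unit) ≃ M₂ × BO' :=
    ⟨fun p => (p.2.1, p.1), fun p => (p.2, (p.1, ())), fun _ => rfl, fun _ => rfl⟩
  -- Retract B_I to A_O' with the flag in the environment, then apply `U₁`. On inputs in the range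
  -- of `f` the flag is `none`, and `V₁` acts there as `U₁` (see `e₁`).
  let V₁ : Matrix (M × M₁) ((BI' × M₂) × Option M) ℂ :=
    basisMap φ * (U₁ ⊗ₖ (1 : Matrix (Option M) (Option M) ℂ))
  -- Apply `U₂`, then embed C_I' into the second wire; the final memory `M₃` is the environment.
  let V₂ : Matrix (BO' × (M₂ × Unit)) (N × M₃) ℂ := U₂.submatrix s id * basisMap ψ
  have hV₁ : V₁ * V₁ᴴ = 1 := by
    refine mul_conjTranspose_mul_self (basisMap_mul_conjTranspose hφ) ?_
    rw [conjTranspose_kronecker, ← mul_kronecker_mul, hU₁]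
    simp
  have hV₂ : V₂ * V₂ᴴ = 1 := by
    refine mul_conjTranspose_mul_self ?_ (basisMap_mul_conjTranspose hψ)
    rw [conjTranspose_submatrix, ← submatrix_mul _ _ s id s Function.bijective_id, hU₂]
    simp
  refine ⟨_, ⟨M₂, inferInstance, inferInstance, _, _, isChannel_stinespringChoi hV₁,
    isChannel_stinespringChoi hV₂, rfl⟩, ?_⟩
  intro m₁ a n bI' bO' m₁' a' n' bI₁' bO₁'
  have e₁ : ∀ m a b m₂ e, V₁ (f a, m) ((b, m₂), e) =
      if e = none then U₁ (m, a) (b, m₂) else 0 := by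
    intro m a b m₂ e
    simp only [V₁, basisMap_mul_apply]
    simp [φ, hrf, kroneckerMap_apply, Matrix.one_apply, eq_comm]
  have e₂ : ∀ b m n e, V₂ (b, (m, ())) (n, e) =
      ∑ c, if g c = n then U₂ (m, b) (c, e) else 0 := by
    intro b m n e
    simp [V₂, Matrix.mul_apply, basisMap, ψ, s, Fintype.sum_prod_type, ite_and]
  have h₁ : ∀ m₂ m₂', stinespringChoi V₁ ((f a, m₁), (bI', m₂)) ((f a', m₁'), (bI₁', m₂')) =
      U₁ (m₁, a) (bI', m₂) * star (U₁ (m₁', a') (bI₁', m₂')) := by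
    intro m₂ m₂'
    simp [stinespringChoi, e₁]
  have h₂ : ∀ m₂ m₂', stinespringChoi V₂ ((bO', (m₂, ())), n) ((bO₁', (m₂', ())), n') =
      ∑ c, ∑ c', if g c = n then if g c' = n' then
        stinespringChoi U₂ ((m₂, bO'), c) ((m₂', bO₁'), c') else 0 else 0 := by
    intro m₂ m₂'
    simp only [stinespringChoi, of_apply, e₂, star_sum, Finset.sum_mul_sum]
    rw [Finset.sum_comm]
    refine Finset.sum_congr rfl fun c _ => ?_
    rw [Finset.sum_comm]
    refine Finset.sum_congr rfl fun c' _ => ?_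
    by_cases hc : g c = n <;> by_cases hc' : g c' = n' <;> simp [hc, hc']
  simp only [localOperation_apply, h₁, h₂, Finset.mul_sum]
  simp only [Finset.sum_comm (s := (Finset.univ : Finset M₂)) (t := (Finset.univ : Finset CI'))]
  refine Finset.sum_congr rfl fun c _ => Finset.sum_congr rfl fun c' _ => ?_
  by_cases hc : g c = n <;> by_cases hc' : g c' = n' <;> simp [hc, hc']

/-- The third party restricts `C_I` to `C_I'`, discards `C_O'` and prepares a fixed state. -/
theorem exists_third_localOperation [Fintype N] [Fintype CO] [Fintype CI'] [Fintype CO']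
    [DecidableEq N] [DecidableEq CO] [DecidableEq CI'] [DecidableEq CO'] [Nonempty CO]
    [Nonempty CI'] {g : CI' → N} (hg : Function.Injective g) :
    ∃ K : Matrix ((Unit × Unit) × ((N × CO) × (CI' × CO')))
        ((Unit × Unit) × ((N × CO) × (CI' × CO'))) ℂ,
      IsLocalOperation K ∧ ∀ c cI' cO' c₁ cI₁' cO₁',
        ∑ o, K (((), ()), ((g c, o), (cI', cO'))) (((), ()), ((g c₁, o), (cI₁', cO₁'))) =
          if c = cI' then if c₁ = cI₁' then (1 : Matrix CO' CO' ℂ) cO' cO₁' else 0 else 0 := by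
  obtain ⟨r, hr, hrg⟩ := exists_dilated_retraction hg
  obtain ⟨o₀⟩ := ‹Nonempty CO›
  let φ : N × Unit → (CI' × Unit) × Option N := fun p => (((r p.1).1, ()), (r p.1).2)
  -- C_O is prepared in `o₀` and C_O' goes to the environment, whose trace produces the identity on
  -- C_O' required of a comb.
  let ψ : CO' × (Unit × Unit) → CO × CO' := fun p => (o₀, p.1)
  have hφ : Function.Injective φ := by
    rintro ⟨c, m⟩ ⟨c', m'⟩ h
    simp only [φ, Prod.mk.injEq, and_true] at h
    rw [hr (Prod.ext h.1 h.2)]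
  have hψ : Function.Injective ψ := by
    rintro ⟨c, ⟨⟩, ⟨⟩⟩ ⟨c', ⟨⟩, ⟨⟩⟩ h
    simpa [ψ] using h
  refine ⟨_, ⟨Unit, inferInstance, inferInstance, _, _,
    isChannel_stinespringChoi (basisMap_mul_conjTranspose hφ),
    isChannel_stinespringChoi (basisMap_mul_conjTranspose hψ), rfl⟩, ?_⟩
  intro c cI' cO' c₁ cI₁' cO₁'
  simp only [localOperation_apply, stinespringChoi_basisMap, φ, ψ, hrg]
  by_cases h₁ : c = cI' <;> by_cases h₂ : c₁ = cI₁' <;>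
    simp [h₁, h₂, ite_and, Matrix.one_apply]

end LocalOperations

/-! ### Assembling the adapter -/

section Main

variable {AI M N CO AI' AO' BI' BO' CI' CO' : Type}

/-- Pushing `X` forward along `g` and pairing with `F` is pairing `X` with the pullback of `F`. It
joins the embedding of C_I' by the second party to its retraction by the third. -/
theorem sum_sum_ite_mul {K L : Type*} [Fintype K] [Fintype L] [DecidableEq L] (g : K → L)
    (X : K → K → ℂ) (F : L → L → ℂ) :
    ∑ l, ∑ l', (∑ k, ∑ k', if g k = l then if g k' = l' then X k k' else 0 else 0) * F l l' =
      ∑ k, ∑ k', X k k' * F (g k) (g k') := by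
  simp only [Finset.sum_mul]
  calc _ = ∑ l, ∑ k, ∑ l', ∑ k',
        (if g k = l then if g k' = l' then X k k' else 0 else 0) * F l l' :=
        Finset.sum_congr rfl fun l _ => Finset.sum_comm
    _ = ∑ k, ∑ l, ∑ k', ∑ l',
        (if g k = l then if g k' = l' then X k k' else 0 else 0) * F l l' := by
        rw [Finset.sum_comm]
        exact Finset.sum_congr rfl fun k _ => Finset.sum_congr rfl fun l _ => Finset.sum_comm
    _ = _ := by simp [ite_mul, Finset.sum_ite_irrel]

theorem sum_sum_sum_sum_comm {K L : Type*} [Fintype K] [Fintype L] (F : K → K → L → L → ℂ) :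
    ∑ k, ∑ k', ∑ l, ∑ l', F k k' l l' = ∑ l, ∑ l', ∑ k, ∑ k', F k k' l l' := by
  calc _ = ∑ k, ∑ l, ∑ k', ∑ l', F k k' l l' := Finset.sum_congr rfl fun k _ => Finset.sum_comm
    _ = ∑ l, ∑ k, ∑ l', ∑ k', F k k' l l' := by
        rw [Finset.sum_comm]
        exact Finset.sum_congr rfl fun l _ => Finset.sum_congr rfl fun k _ => Finset.sum_comm
    _ = _ := Finset.sum_congr rfl fun l _ => Finset.sum_comm

/-- Associativity of the link product: for fixed labels of the shared state, the process is
contracted with the local operations first. -/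
theorem applyAdapter_linkAll_tensorLocal {AO BI BO CI T₁ T₂ T₃ T₄ T₅ T₆ : Type*}
    [Fintype AI] [Fintype AO] [Fintype BI] [Fintype BO] [Fintype CI] [Fintype CO]
    [Fintype AI'] [Fintype AO'] [Fintype BI'] [Fintype BO'] [Fintype CI'] [Fintype CO']
    [Fintype T₁] [Fintype T₂] [Fintype T₃] [Fintype T₄] [Fintype T₅] [Fintype T₆]
    (τ : Matrix (TriIndex T₁ T₂ T₃ T₄ T₅ T₆) (TriIndex T₁ T₂ T₃ T₄ T₅ T₆) ℂ)
    (KA : Matrix ((T₁ × T₂) × ((AI × AO) × (AI' × AO')))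
      ((T₁ × T₂) × ((AI × AO) × (AI' × AO'))) ℂ)
    (KB : Matrix ((T₃ × T₄) × ((BI × BO) × (BI' × BO')))
      ((T₃ × T₄) × ((BI × BO) × (BI' × BO'))) ℂ)
    (KC : Matrix ((T₅ × T₆) × ((CI × CO) × (CI' × CO')))
      ((T₅ × T₆) × ((CI × CO) × (CI' × CO'))) ℂ)
    (W : Matrix (TriIndex AI AO BI BO CI CO) (TriIndex AI AO BI BO CI CO) ℂ)
    (z z' : TriIndex AI' AO' BI' BO' CI' CO') :
    applyAdapter (linkAll τ (tensorLocal KA KB KC)) W z z' =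
      ∑ t, ∑ t', τ t t' * ∑ w, ∑ w', W w w' *
        (KA (t.1, (w.1, z.1)) (t'.1, (w'.1, z'.1)) *
          (KB (t.2.1, (w.2.1, z.2.1)) (t'.2.1, (w'.2.1, z'.2.1)) *
            KC (t.2.2, (w.2.2, z.2.2)) (t'.2.2, (w'.2.2, z'.2.2)))) := by
  have h : ∀ w w' t t', W w w' * (τ t t' *
      tensorLocal KA KB KC (t, (w, z)) (t', (w', z'))) = τ t t' * (W w w' *
        (KA (t.1, (w.1, z.1)) (t'.1, (w'.1, z'.1)) *
          (KB (t.2.1, (w.2.1, z.2.1)) (t'.2.1, (w'.2.1, z'.2.1)) *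
            KC (t.2.2, (w.2.2, z.2.2)) (t'.2.2, (w'.2.2, z'.2.2))))) :=
    fun _ _ _ _ => mul_left_comm _ _ _
  simp only [applyAdapter, linkAll_apply, Finset.mul_sum, h]
  exact sum_sum_sum_sum_comm _

/-- Every comb is obtained from `W^{A → B → C}` by local operations and shared entanglement, as
soon as `A_O'` embeds into the first channel and `C_I'` into the second one. -/
theorem exists_isLOSE_applyAdapter_eq
    [Fintype AI] [Fintype M] [Fintype N] [Fintype CO]
    [Fintype AI'] [Fintype AO'] [Fintype BI'] [Fintype BO'] [Fintype CI'] [Fintype CO']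
    [DecidableEq AI] [DecidableEq M] [DecidableEq N] [DecidableEq CO]
    [DecidableEq AI'] [DecidableEq AO'] [DecidableEq BI'] [DecidableEq BO'] [DecidableEq CI']
    [DecidableEq CO'] [Nonempty CO] [Nonempty AO'] [Nonempty BI'] [Nonempty BO'] [Nonempty CI']
    [Nonempty CO'] {f : AO' → M} (hf : Function.Injective f) {g : CI' → N}
    (hg : Function.Injective g) {ρ : Matrix AI AI ℂ} (hρ : IsState ρ)
    {W : Matrix (TriIndex AI' AO' BI' BO' CI' CO') (TriIndex AI' AO' BI' BO' CI' CO') ℂ}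
    (hW : IsOrderedComb W) :
    ∃ Υ : Matrix (AdapterIndex AI M M N N CO AI' AO' BI' BO' CI' CO')
        (AdapterIndex AI M M N N CO AI' AO' BI' BO' CI' CO') ℂ,
      IsLOSE Υ ∧ applyAdapter Υ (fullySignalling ρ) = W := by
  obtain ⟨M₁, M₂, M₃, _, _, _, _, _, V, U₁, U₂, hV, hU₁, hU₂, hWV⟩ := hW.exists_realization
  obtain ⟨KA, hKA, eA⟩ := exists_first_localOperation (AI := AI) (AI' := AI') hf
  obtain ⟨KB, hKB, eB⟩ := exists_second_localOperation hf hg hU₁ hU₂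
  obtain ⟨KC, hKC, eC⟩ := exists_third_localOperation (CO := CO) (CO' := CO') hg
  -- The initial pure state of the circuit, with A_I' held by the first party and `M₁` by the
  -- second; all other shares are trivial.
  let v : TriIndex AI' Unit M₁ Unit Unit Unit → ℂ := fun t => V t.1.1 t.2.1.1
  have hτ : IsState (vecMulVec v (star v)) := by
    refine ⟨posSemidef_vecMulVec_self_star v, ?_⟩
    rw [← hV]
    simp [trace, vecMulVec_apply, v, Fintype.sum_prod_type, Matrix.mul_apply]
  refine ⟨linkAll (vecMulVec v (star v)) (tensorLocal KA KB KC),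
    ⟨AI', Unit, M₁, Unit, Unit, Unit, inferInstance, inferInstance, inferInstance, inferInstance,
      inferInstance, inferInstance, inferInstance, inferInstance, inferInstance, inferInstance,
      inferInstance, inferInstance, _, KA, KB, KC, hτ, hKA, hKB, hKC, rfl⟩, ?_⟩
  ext ⟨⟨aI, aO⟩, ⟨bI, bO⟩, ⟨cI, cO⟩⟩ ⟨⟨aI', aO'⟩, ⟨bI', bO'⟩, ⟨cI', cO'⟩⟩
  -- Since A_I is discarded, only the trace of `ρ` survives; the outputs on the first wire lie in
  -- the range of `f`, where `eB` applies.
  have hA : ∀ t u b b', ∑ a, ∑ a', ρ a a' *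
      KA ((t, ()), ((a, b), (aI, aO))) ((u, ()), ((a', b'), (aI', aO'))) =
      if t = aI then if u = aI' then if f aO = b then if f aO' = b' then 1
        else 0 else 0 else 0 else 0 := by
    intro t u b b'
    have h : ∑ a, ρ a a = 1 := hρ.2
    simp [eA, Finset.sum_ite_irrel, h]
  have hBC : ∀ m m', ∑ c, ∑ c',
      KB ((m, ()), ((f aO, c), (bI, bO))) ((m', ()), ((f aO', c'), (bI', bO'))) *
        ∑ o, KC (((), ()), ((c, o), (cI, cO))) (((), ()), ((c', o), (cI', cO'))) =
      (∑ m₂, ∑ m₂', U₁ (m, aO) (bI, m₂) * star (U₁ (m', aO') (bI', m₂')) *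
        stinespringChoi U₂ ((m₂, bO), cI) ((m₂', bO'), cI')) *
          (1 : Matrix CO' CO' ℂ) cO cO' := by
    intro m m'
    simp only [eB]
    rw [sum_sum_ite_mul g]
    simp only [eC]
    simp
  rw [applyAdapter_linkAll_tensorLocal, hWV]
  simp only [vecMulVec_apply, Pi.star_apply]
  have hw : ∀ t t' : TriIndex AI' Unit M₁ Unit Unit Unit, ∑ w, ∑ w',
        (fullySignalling ρ : Matrix (TriIndex AI M M N N CO) (TriIndex AI M M N N CO) ℂ) w w' *
        (KA (t.1, (w.1, (aI, aO))) (t'.1, (w'.1, (aI', aO'))) *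
          (KB (t.2.1, (w.2.1, (bI, bO))) (t'.2.1, (w'.2.1, (bI', bO'))) *
            KC (t.2.2, (w.2.2, (cI, cO))) (t'.2.2, (w'.2.2, (cI', cO'))))) =
      if t.1.1 = aI then if t'.1.1 = aI' then
        (∑ m₂, ∑ m₂', U₁ (t.2.1.1, aO) (bI, m₂) * star (U₁ (t'.2.1.1, aO') (bI', m₂')) *
        stinespringChoi U₂ ((m₂, bO), cI) ((m₂', bO'), cI')) *
          (1 : Matrix CO' CO' ℂ) cO cO' else 0 else 0 := by
    rintro ⟨⟨t, _⟩, ⟨m, _⟩, _⟩ ⟨⟨t', _⟩, ⟨m', _⟩, _⟩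
    rw [sum_fullySignalling_mul ρ
      (fun p q => KA ((t, ()), (p, (aI, aO))) ((t', ()), (q, (aI', aO'))))
      (fun p q => KB ((m, ()), (p, (bI, bO))) ((m', ()), (q, (bI', bO'))))
      (fun p q => KC (((), ()), (p, (cI, cO))) (((), ()), (q, (cI', cO'))))]
    simp only [hA, ite_mul, one_mul, zero_mul, Finset.sum_ite_irrel, Finset.sum_const_zero,
      Finset.sum_ite_eq, Finset.mem_univ, if_true, hBC]
  have collapse : ∀ (X : M₁ → M₁ → ℂ) (d : ℂ), ∑ t, ∑ t', v t * star (v t') *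
      (if t.1.1 = aI then if t'.1.1 = aI' then X t.2.1.1 t'.2.1.1 * d else 0 else 0) =
      (∑ m, ∑ m', V aI m * star (V aI' m') * X m m') * d := by
    intro X d
    simp [v, Fintype.sum_prod_type, Finset.sum_ite_irrel, Finset.sum_mul, mul_assoc]
  simp only [hw]
  exact collapse (fun m m' => ∑ m₂, ∑ m₂', U₁ (m, aO) (bI, m₂) * star (U₁ (m', aO') (bI', m₂')) *
    stinespringChoi U₂ ((m₂, bO), cI) ((m₂', bO'), cI')) ((1 : Matrix CO' CO' ℂ) cO cO')

end Main

end CausalConnection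

theorem mainTheorem6
    -- `m` is the dimension of `A_O` and of `B_I`; `n` is the dimension of `B_O` and of `C_I`
    (dAI m n dCO : ℕ) (hdAI : 0 < dAI) (hm : 0 < m) (hn : 0 < n) (hdCO : 0 < dCO)
    (ρ : Matrix (Fin dAI) (Fin dAI) ℂ) (hρ : IsState ρ) :
    IsOrderedComb
      (fullySignalling ρ : Matrix
        (TriIndex (Fin dAI) (Fin m) (Fin m) (Fin n) (Fin n) (Fin dCO))
        (TriIndex (Fin dAI) (Fin m) (Fin m) (Fin n) (Fin n) (Fin dCO)) ℂ) ∧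
    ∀ (dAI' dAO' dBI' dBO' dCI' dCO' : ℕ),
      0 < dAI' → 0 < dAO' → 0 < dBI' → 0 < dBO' → 0 < dCI' → 0 < dCO' →
      dAI' ≤ dAI → dAO' ≤ m → dBI' ≤ m → dBO' ≤ n → dCI' ≤ n → dCO' ≤ dCO →
      ∀ W' : Matrix
          (TriIndex (Fin dAI') (Fin dAO') (Fin dBI') (Fin dBO') (Fin dCI') (Fin dCO'))
          (TriIndex (Fin dAI') (Fin dAO') (Fin dBI') (Fin dBO') (Fin dCI') (Fin dCO')) ℂ,
        IsOrderedComb W' →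
        ∃ Υ : Matrix
            (AdapterIndex (Fin dAI) (Fin m) (Fin m) (Fin n) (Fin n) (Fin dCO)
              (Fin dAI') (Fin dAO') (Fin dBI') (Fin dBO') (Fin dCI') (Fin dCO'))
            (AdapterIndex (Fin dAI) (Fin m) (Fin m) (Fin n) (Fin n) (Fin dCO)
              (Fin dAI') (Fin dAO') (Fin dBI') (Fin dBO') (Fin dCI') (Fin dCO')) ℂ,
          IsLOSE Υ ∧ IsNonSignalling Υ ∧ applyAdapter Υ (fullySignalling ρ) = W' := by
  refine ⟨isOrderedComb_fullySignalling hρ, ?_⟩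
  intro dAI' dAO' dBI' dBO' dCI' dCO' _ hAO' hBI' hBO' hCI' hCO' _ hAO _ _ hCI _ W' hW'
  have := Fin.pos_iff_nonempty.mp hdCO
  have := Fin.pos_iff_nonempty.mp hAO'
  have := Fin.pos_iff_nonempty.mp hBI'
  have := Fin.pos_iff_nonempty.mp hBO'
  have := Fin.pos_iff_nonempty.mp hCI'
  have := Fin.pos_iff_nonempty.mp hCO'
  obtain ⟨Υ, hΥ, h⟩ := exists_isLOSE_applyAdapter_eq
    (CO := Fin dCO) (AO' := Fin dAO') (CI' := Fin dCI') (Fin.castLE_injective hAO)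
    (Fin.castLE_injective hCI) hρ hW'
  exact ⟨Υ, hΥ, hΥ.isNonSignalling, h⟩
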